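/- **Theorem (Desargues's theorem in the geometries $\mathrm{Sol}$, $\widetilde{SL_2\mathbb R}$, $H^2\times\mathbb R$, $S^2\times\mathbb R$).** *Translation curves.* In $\mathrm{Sol}=\mathbb R^3$ the translation by $(x,y,z)$ is $(a,b,c)\mapsto(x+ae^{-z},\,y+be^{z},\,z+c)$; in $\widetilde{SL_2\mathbb R}$, the universal cover of $SL_2(\mathbb R)$, translations are the left translations. A translation curve of these two geometries is a (complete, non-constant) curve whose tangent vector at each of its points is the translate of one fixed tangent vector at the origin. In $H^2\times\mathbb R$ and $S^2\times\mathbb R$ the translation curves are the geodesics of the product metric. *Surface.* The surface $\mathcal S_{A_1A_2A_3}$ is the set of all points $P$ from which translation curves (in $S^2\times\mathbb R$: shortest ones) can be drawn to $A_1,A_2,A_3$ with coplanar tangents at $P$. In $H^2\times\mathbb R$ and $S^2\times\mathbb R$ the three points are of *general type* if their projections to the base $H^2$ or $S^2$ are not on one line of the base (geodesic line, great circle), and of *fibre type* otherwise. For fibre type in $H^2\times\mathbb R$, let instead $\mathcal S_{A_1A_2A_3}$ be the part of $H^2\times\mathbb R$ lying over the span in $\mathbb R^3$ of the projections of $A_1,A_2,A_3$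 (hyperboloid model of $H^2$), which is the vertical plane $c\times\mathbb R$ through $A_1,A_2,A_3$ ($c$ a geodesic line) unless the three projections coincide; for fibre type in $S^2\times\mathbb R$, let $\mathcal S_{A_1A_2A_3}$ be an open half $c^+\times\mathbb R$ of the vertical surface through the points, $c^+$ an open half great circle. *Curves.* The curves considered are: in $\mathrm{Sol}$ and $\widetilde{SL_2\mathbb R}$ the translation curves; for fibre type in $H^2\times\mathbb R$ the translation curves, and for fibre type in $S^2\times\mathbb R$ the fibres, and the arcs of translation curves running once over the whole open half great circle $c^+$; for general type in $H^2\times\mathbb R$ or $S^2\times\mathbb R$ the connecting curves of the surface, i.e. the parts of $\mathcal S_{A_1A_2A_3}$ lying over the lines of the base. Write $g_{PQ}$ for the curve through two different points $P,Q$, if there is exactly one. Three points form a triangle if $g_{PQ}$ is defined for any two of them and no curve contains all three. *Hypotheses.* Let $A_1A_2A_3$ and $B_1B_2B_3$ be triangles with all $A_i,B_i$ on $\mathcal S=\mathcal S_{A_1A_2A_3}$, and suppose that they are perspective with respect to a point $S\in\mathcal S$: the curves $g_{A_1B_1},g_{A_2B_2},g_{A_3B_3}$ are defined and pass through $S$.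 Suppose that for $1\le i<j\le 3$ the curves $g_{A_iA_j}$ and $g_{B_iB_j}$ are different and have a point of intersection $M_{ij}$. *Conclusion.* In $\mathrm{Sol}$, $H^2\times\mathbb R$ and $S^2\times\mathbb R$ the points $M_{12},M_{13},M_{23}$ lie on one curve. In $\widetilde{SL_2\mathbb R}$ there are points $Q_{ij}$ lying on one translation curve such that $Q_{ij}$ and $M_{ij}$ have the same image in the projective model (the solid hyperboloid $\det>0$ in the projective space of $2\times2$ matrices); and if any two of $M_{12},M_{13},M_{23}$ can be joined by a translation curve, then these three points themselves lie on one translation curve. -/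

import Mathlib

noncomputable section

namespace Thurston

/-! ### Incidence vocabulary

Throughout, `L` is the family of curves of a geometry (or of a surface in it), each curve being
given as the set of its points, and `Surf` is the surface on which the triangles lie. -/

section Incidence

variable {X : Type}

/-- `g` is the curve of the family `L` determined by the two different points `P`, `Q`: it passes
through both and it is the only curve of the family that does. -/
def IsJoin (L : Set (Set X)) (P Q : X) (g : Set X) : Prop :=
  P ≠ Q ∧ g ∈ L ∧ P ∈ g ∧ Q ∈ g ∧ ∀ h ∈ L, P ∈ h → Q ∈ h → h = g

/-- Three points form a triangle if any two of them determine a curve (a side) and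
the three points do not lie on one curve. -/
def IsTriangle (L : Set (Set X)) (A : Fin 3 → X) : Prop :=
  (∀ i j, i ≠ j → ∃ g, IsJoin L (A i) (A j) g) ∧ ¬ ∃ g ∈ L, ∀ i, A i ∈ g

/-- The triangles `A`, `B` on the surface `Surf` are centrally perspective with respect to the
point `S` of `Surf`: the three curves joining corresponding vertices pass through `S`. -/
def CentrallyPerspective (Surf : Set X) (L : Set (Set X)) (A B : Fin 3 → X) (S : X) : Prop :=
  IsTriangle L A ∧ IsTriangle L B ∧ (∀ i, A i ∈ Surf) ∧ (∀ i, B i ∈ Surf) ∧ S ∈ Surf ∧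
    ∀ i, ∃ g, IsJoin L (A i) (B i) g ∧ S ∈ g

/-- `M` is a point of intersection of the corresponding sides `A i A j` and `B i B j`,
these sides lying on different curves. -/
def IsSideIntersection (L : Set (Set X)) (A B : Fin 3 → X) (i j : Fin 3) (M : X) : Prop :=
  ∃ g h, IsJoin L (A i) (A j) g ∧ IsJoin L (B i) (B j) h ∧ g ≠ h ∧ M ∈ g ∧ M ∈ h

/-- The hypotheses of the theorem of Desargues: two centrally perspective triangles and
the three points of intersection of their corresponding sides. -/
def DesarguesConfiguration (Surf : Set X) (L : Set (Set X)) (A B : Fin 3 → X)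
    (S M₁₂ M₁₃ M₂₃ : X) : Prop :=
  CentrallyPerspective Surf L A B S ∧ IsSideIntersection L A B 0 1 M₁₂ ∧
    IsSideIntersection L A B 0 2 M₁₃ ∧ IsSideIntersection L A B 1 2 M₂₃

/-- The three points lie on one curve of the family `L`. -/
def OnOneCurve (L : Set (Set X)) (P Q R : X) : Prop :=
  ∃ g ∈ L, P ∈ g ∧ Q ∈ g ∧ R ∈ g

/-- The two points lie on some common curve of the family `L`. -/
def Joinable (L : Set (Set X)) (P Q : X) : Prop :=
  ∃ g ∈ L, P ∈ g ∧ Q ∈ g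

end Incidence

/-! ### Sol -/

/-- The points of Sol in the affine coordinates `(x, y, z)`; the translation by `(x, y, z)` is
`(a, b, c) ↦ (x + a * exp (-z), y + b * exp z, z + c)`. -/
abbrev Sol : Type := Fin 3 → ℝ

/-- The tangent vector `u` at the origin, carried to `P` by the translation that maps
the origin to `P`. -/
def Sol.translate (P : Sol) (u : Fin 3 → ℝ) : Fin 3 → ℝ :=
  ![u 0 * Real.exp (-P 2), u 1 * Real.exp (P 2), u 2]

/-- The tangent vector of `γ` at each of its points is the translated vector `u`. -/
def Sol.IsTranslationMotion (u : Fin 3 → ℝ) (γ : ℝ → Sol) : Prop :=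
  ∀ t, HasDerivAt γ (Sol.translate (γ t) u) t

/-- The translation curves of Sol. -/
def Sol.curves : Set (Set Sol) :=
  {g | ∃ u : Fin 3 → ℝ, u ≠ 0 ∧ ∃ γ, Sol.IsTranslationMotion u γ ∧ g = Set.range γ}

/-- The surface of the translation triangle `A`: the points `P` at which the tangents of
the translation curves drawn from `P` to the vertices are coplanar. (For `P = A i` the
tangent vector is `0`; so the vertices belong to the surface.) -/
def Sol.surface (A : Fin 3 → Sol) : Set Sol :=
  {P | ∃ u : Fin 3 → Fin 3 → ℝ,
    (∀ i, ∃ γ, Sol.IsTranslationMotion (u i) γ ∧ γ 0 = P ∧ γ 1 = A i) ∧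
    ¬ LinearIndependent ℝ (fun i => Sol.translate P (u i))}

/-! ### The universal cover of SL(2, ℝ) -/

/-- The universal covering space of `SL(2, ℝ)`: a matrix with lower row `(c, d)` together with
a real number `angle` that is a value of the argument of the non-zero complex number `d + c i`.
(The map `g ↦ (d, c)` onto the punctured plane has contractible fibres, so the pull-back of the
universal cover of the punctured plane is the universal cover of `SL(2, ℝ)`.) -/
structure SL2Cover where
  mat : Matrix (Fin 2) (Fin 2) ℝ
  det_mat : mat.det = 1
  angle : ℝ
  cos_angle : mat 1 1 = √(mat 1 0 ^ 2 + mat 1 1 ^ 2) * Real.cos angle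
  sin_angle : mat 1 0 = √(mat 1 0 ^ 2 + mat 1 1 ^ 2) * Real.sin angle

/-- The tangent vector of `γ` at each of its points is the left translate of the tangent vector
`U` at the identity. The coordinates of the cover are the matrix, which is differentiable,
and the angle, which varies continuously. -/
def SL2Cover.IsTranslationMotion (U : Matrix (Fin 2) (Fin 2) ℝ) (γ : ℝ → SL2Cover) : Prop :=
  (∀ t i j, HasDerivAt (fun s => (γ s).mat i j) (((γ t).mat * U) i j) t) ∧
    Continuous fun t => (γ t).angle

/-- The translation curves of the universal cover of `SL(2, ℝ)`; the tangent vectors at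
the identity are the matrices of trace `0`. -/
def SL2Cover.curves : Set (Set SL2Cover) :=
  {g | ∃ U : Matrix (Fin 2) (Fin 2) ℝ, U.trace = 0 ∧ U ≠ 0 ∧
    ∃ γ, SL2Cover.IsTranslationMotion U γ ∧ g = Set.range γ}

/-- The surface of the translation triangle `A`: the points `P` at which the tangents of
the translation curves drawn from `P` to the vertices are coplanar. -/
def SL2Cover.surface (A : Fin 3 → SL2Cover) : Set SL2Cover :=
  {P | ∃ U : Fin 3 → Matrix (Fin 2) (Fin 2) ℝ, (∀ i, (U i).trace = 0) ∧
    (∀ i, ∃ γ, SL2Cover.IsTranslationMotion (U i) γ ∧ γ 0 = P ∧ γ 1 = A i) ∧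
    ¬ LinearIndependent ℝ (fun i => P.mat * U i)}

/-- Two points of the cover are over the same point of the projective model, the solid
hyperboloid `det > 0` in the projective space of the `2 × 2` matrices. -/
def SL2Cover.SameProjectivePoint (P Q : SL2Cover) : Prop :=
  P.mat = Q.mat ∨ P.mat = -Q.mat

/-! ### H² × ℝ -/

/-- The Lorentz form on `ℝ³`. -/
def lorentz (x y : Fin 3 → ℝ) : ℝ := -(x 0 * y 0) + x 1 * y 1 + x 2 * y 2

/-- The hyperbolic plane (hyperboloid model). -/
abbrev H2 : Type := {p : Fin 3 → ℝ // lorentz p p = -1 ∧ 0 < p 0}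

/-- `e` is a unit tangent vector of the hyperbolic plane at `p`. -/
def H2.IsUnitTangent (p : H2) (e : Fin 3 → ℝ) : Prop :=
  lorentz p.1 e = 0 ∧ lorentz e e = 1

/-- The geodesic lines of the hyperbolic plane. -/
def H2.lines : Set (Set H2) :=
  {c | ∃ (p : H2) (e : Fin 3 → ℝ), H2.IsUnitTangent p e ∧
    c = {x | ∃ t : ℝ, x.1 = Real.cosh t • p.1 + Real.sinh t • e}}

abbrev H2R : Type := H2 × ℝ

/-- `Q` is the point reached at time `1` by the geodesic (that is, translation) curve of `H² × ℝ`
that starts at `P` with velocity `(a • e, b)`, where `e` is a unit tangent vector. -/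
def H2R.Reaches (P : H2R) (e : Fin 3 → ℝ) (a b : ℝ) (Q : H2R) : Prop :=
  Q.1.1 = Real.cosh a • P.1.1 + Real.sinh a • e ∧ Q.2 = P.2 + b

/-- The translation curves of `H² × ℝ`; they are the geodesics. -/
def H2R.translationCurves : Set (Set H2R) :=
  {g | ∃ (P : H2R) (e : Fin 3 → ℝ) (a b : ℝ), H2.IsUnitTangent P.1 e ∧ (a, b) ≠ (0, 0) ∧
    g = {Q | ∃ t : ℝ, H2R.Reaches P e (t * a) (t * b) Q}}

/-- The triangle is of general type: its vertices are not in one plane `c × ℝ` with `c` a geodesic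
of the base, i.e. the projections are not on one plane through the origin of `ℝ³`. -/
def H2R.GeneralType (A : Fin 3 → H2R) : Prop :=
  LinearIndependent ℝ fun i => (A i).1.1

/-- The points at which the tangents of the translation curves drawn to the vertices are
coplanar. -/
def H2R.locus (A : Fin 3 → H2R) : Set H2R :=
  {P | ∃ (e : Fin 3 → Fin 3 → ℝ) (a b : Fin 3 → ℝ),
    (∀ i, H2.IsUnitTangent P.1 (e i) ∧ H2R.Reaches P (e i) (a i) (b i) (A i)) ∧
    ¬ LinearIndependent ℝ (fun i => ((a i • e i, b i) : (Fin 3 → ℝ) × ℝ))}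

/-- The surface of the translation triangle `A`. For a triangle of fibre type it is the
vertical plane `c × ℝ` that contains the vertices. -/
def H2R.surface (A : Fin 3 → H2R) : Set H2R :=
  {P | (H2R.GeneralType A ∧ P ∈ H2R.locus A) ∨
    (¬ H2R.GeneralType A ∧ P.1.1 ∈ Submodule.span ℝ (Set.range fun i => (A i).1.1))}

/-- The curves on the surface of the triangle `A`. For fibre type they are the translation curves.
A surface of general type does not contain the translation curves that connect its points;
there the connecting curve of two points is the projection of their translation curve along the
fibres to the surface: the part of the surface over a geodesic line of the base. (Over the
line through the projections of two vertices this is the translation curve itself.) -/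
def H2R.curves (A : Fin 3 → H2R) : Set (Set H2R) :=
  {g | (H2R.GeneralType A ∧ ∃ c ∈ H2.lines, g = H2R.surface A ∩ Prod.fst ⁻¹' c) ∨
    (¬ H2R.GeneralType A ∧ g ∈ H2R.translationCurves)}

/-! ### S² × ℝ -/

abbrev E3 : Type := EuclideanSpace ℝ (Fin 3)

abbrev S2 : Type := Metric.sphere (0 : E3) 1

/-- `e` is a unit tangent vector of the sphere at `p`. -/
def S2.IsUnitTangent (p : S2) (e : E3) : Prop :=
  inner ℝ p.1 e = 0 ∧ ‖e‖ = 1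

/-- The great circles. -/
def S2.lines : Set (Set S2) :=
  {c | ∃ (p : S2) (e : E3), S2.IsUnitTangent p e ∧
    c = {x | ∃ t : ℝ, x.1 = Real.cos t • p.1 + Real.sin t • e}}

abbrev S2R : Type := S2 × ℝ

/-- `Q` is the point reached at time `1` by the geodesic (that is, translation) curve of `S² × ℝ`
that starts at `P` with velocity `(a • e, b)`, where `e` is a unit tangent vector. -/
def S2R.Reaches (P : S2R) (e : E3) (a b : ℝ) (Q : S2R) : Prop :=
  Q.1.1 = Real.cos a • P.1.1 + Real.sin a • e ∧ Q.2 = P.2 + b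

/-- The triangle is of general type: the projections of its vertices to the base are not
on one great circle. -/
def S2R.GeneralType (A : Fin 3 → S2R) : Prop :=
  LinearIndependent ℝ fun i => (A i).1.1

/-- The surface of a translation triangle of general type: the points at which the tangents
of the (shortest) translation curves drawn to the vertices are coplanar. -/
def S2R.surface (A : Fin 3 → S2R) : Set S2R :=
  {P | ∃ (e : Fin 3 → E3) (a b : Fin 3 → ℝ),
    (∀ i, S2.IsUnitTangent P.1 (e i) ∧ 0 ≤ a i ∧ a i ≤ Real.pi ∧
      S2R.Reaches P (e i) (a i) (b i) (A i)) ∧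
    ¬ LinearIndependent ℝ (fun i => ((a i • e i, b i) : E3 × ℝ))}

/-- The connecting curves on the surface of a triangle of general type: the parts of the surface
over the great circles of the base. -/
def S2R.curves (A : Fin 3 → S2R) : Set (Set S2R) :=
  {g | ∃ c ∈ S2.lines, g = S2R.surface A ∩ Prod.fst ⁻¹' c}

/-- For a triangle of fibre type: the open half of the vertical surface `c × ℝ` containing
the vertices (`c` a great circle) that lies over the open half circle of `c` with middle
point `n`. In the projective model it is an open half-plane bounded by a line through the
origin. -/
def S2R.halfPlane (A : Fin 3 → S2R) (n : S2) : Set S2R :=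
  {P | P.1.1 ∈ Submodule.span ℝ (Set.range fun i => (A i).1.1) ∧ 0 < inner ℝ n.1 P.1.1}

/-- The arcs of translation curves of `S² × ℝ` over the open half great circles with middle
point `n`, and the fibres over the points of these half circles. -/
def S2R.arcs (n : S2) : Set (Set S2R) :=
  {g | (∃ (e : E3) (z w : ℝ), S2.IsUnitTangent n e ∧
      g = {Q | ∃ t : ℝ, |t| < Real.pi / 2 ∧ S2R.Reaches (n, z) e t (t * w) Q}) ∨
    ∃ x : S2, 0 < inner ℝ n.1 x.1 ∧ g = {Q | Q.1 = x}}

end Thurston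

end

/-! In every geometry a suitable map turns the curves into straight lines, and Desargues's theorem
of projective space applies. That theorem is a computation with vectors
(`not_linearIndependent_of_perspective`). Write the centre as `s = αᵢ aᵢ + βᵢ bᵢ` for `i = 0, 1, 2`.
Then `αᵢ aᵢ - αⱼ aⱼ = βⱼ bⱼ - βᵢ bᵢ` lies in both planes of corresponding sides, so it represents
their intersection, and the three vectors of this form satisfy an obvious linear relation.
Coplanarity of the triangles plays no role.

`DesarguesConfiguration.not_linearIndependent` transports this along a map `φ` from points to
non-zero vectors. The map must send joins into projective lines, and intersecting joins with the
same image line must be equal. The remaining task is to go back from dependent vectors to a common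
curve.

In `Sol` the chart `(exp z, x * exp z, y)` sends the translation curves to the intersections of
straight lines with an open half-space. A vertical plane of `H² × ℝ` develops to the Euclidean
plane, and an open half surface of `S² × ℝ` to a strip of width `π`. These cases share
`DesarguesConfiguration.onOneCurve_of_affine`. For general type a curve is determined by the line of
the base below it. The base lies in `ℝ³`, its lines are plane sections, and
`DesarguesConfiguration.onOneCurve_of_base` applies.

In the cover of `SL(2, ℝ)` the map is `mat`, into the four-dimensional space of matrices: the curve
`P exp(tU)` lies in the plane of `P` and `P U`. This map forgets the sheet, so a plane determines a
curve only together with one of its points (`SL2Cover.curve_eq_of_span_eq`). Points over one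
projective point never have a unique join, because every elliptic curve through one contains the
others (`SL2Cover.mem_range_of_sameProjectivePoint`). Hence the conclusion holds for projective
images, and for the points themselves once they are pairwise joinable. -/

noncomputable section

namespace Thurston

/-! ### Desargues's theorem for vectors -/

section VectorDesargues

variable {K V : Type*} [Field K] [AddCommGroup V] [Module K V]

/-- The plane spanned by two vectors has dimension two. -/
theorem finrank_span_pair_of_linearIndependent {v w : V} (h : LinearIndependent K ![v, w]) :
    Module.finrank K (Submodule.span K {v, w}) = 2 := by
  have := finrank_span_eq_card h
  rwa [Matrix.range_cons_cons_empty, Fintype.card_fin] at this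

theorem span_pair_eq_of_linearIndependent {a b d m : V} (hab : LinearIndependent K ![a, b])
    (hdm : LinearIndependent K ![d, m]) (hd : d ∈ Submodule.span K {a, b})
    (hm : m ∈ Submodule.span K {a, b}) :
    Submodule.span K {d, m} = Submodule.span K {a, b} := by
  have : FiniteDimensional K (Submodule.span K {a, b}) :=
    FiniteDimensional.span_of_finite K (by simp)
  apply Submodule.eq_of_le_of_finrank_eq
  · rw [Submodule.span_le]
    rintro x (rfl | rfl)
    · exact hd
    · exact hm
  · rw [finrank_span_pair_of_linearIndependent hab, finrank_span_pair_of_linearIndependent hdm]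

/-- Two different lines of a projective space, with common point `d`, have no other point in
common. -/
theorem exists_smul_of_mem_two_planes {a b a' b' d m : V} (hab : LinearIndependent K ![a, b])
    (hab' : LinearIndependent K ![a', b'])
    (hne : Submodule.span K {a, b} ≠ Submodule.span K {a', b'}) (hd0 : d ≠ 0)
    (hd : d ∈ Submodule.span K {a, b}) (hd' : d ∈ Submodule.span K {a', b'})
    (hm : m ∈ Submodule.span K {a, b}) (hm' : m ∈ Submodule.span K {a', b'}) :
    ∃ c : K, m = c • d := by
  by_contra hc
  have hdm : LinearIndependent K ![d, m] := by
    rw [LinearIndependent.pair_iff' hd0]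
    intro c h
    exact hc ⟨c, h.symm⟩
  exact hne ((span_pair_eq_of_linearIndependent hab hdm hd hm).symm.trans
    (span_pair_eq_of_linearIndependent hab' hdm hd' hm'))

/-- Both expressions for `s` show that `α • a - α' • a'` equals `β' • b' - β • b`, so it lies in
both planes. If it vanished, independence would kill `α` and `β`, hence `s`. Two different planes
share only a line, so `m` is a multiple of it. -/
theorem side_intersection_eq_smul {a b a' b' s m : V} {α α' β β' : K} (hs : s ≠ 0)
    (hab : LinearIndependent K ![a, a']) (hab' : LinearIndependent K ![b, b'])
    (hne : Submodule.span K {a, a'} ≠ Submodule.span K {b, b'})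
    (h : α • a + β • b = s) (h' : α' • a' + β' • b' = s)
    (hm : m ∈ Submodule.span K {a, a'}) (hm' : m ∈ Submodule.span K {b, b'}) :
    ∃ c : K, m = c • (α • a - α' • a') := by
  have e : α • a - α' • a' = β' • b' - β • b := by
    rw [sub_eq_sub_iff_add_eq_add, h, add_comm, h']
  refine exists_smul_of_mem_two_planes hab hab' hne ?_ ?_ ?_ hm hm'
  · intro h0
    have h1 := LinearIndependent.pair_iff.1 hab α (-α') (by rw [neg_smul, ← sub_eq_add_neg, h0])
    have h2 := LinearIndependent.pair_iff.1 hab' (-β) β'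
      (by rw [neg_smul, neg_add_eq_sub, ← e, h0])
    apply hs
    rw [← h, h1.1, neg_eq_zero.1 h2.1]
    simp
  · exact Submodule.sub_mem _ (Submodule.smul_mem _ _ (Submodule.subset_span (by simp)))
      (Submodule.smul_mem _ _ (Submodule.subset_span (by simp)))
  · rw [e]
    exact Submodule.sub_mem _ (Submodule.smul_mem _ _ (Submodule.subset_span (by simp)))
      (Submodule.smul_mem _ _ (Submodule.subset_span (by simp)))

/-- The theorem of Desargues in the projective space of a vector space. -/
theorem not_linearIndependent_of_perspective {a b : Fin 3 → V} {s m₁₂ m₁₃ m₂₃ : V} (hs : s ≠ 0)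
    (ha : ∀ i j, i ≠ j → LinearIndependent K ![a i, a j])
    (hb : ∀ i j, i ≠ j → LinearIndependent K ![b i, b j])
    (hsab : ∀ i, s ∈ Submodule.span K {a i, b i})
    (hne : ∀ i j, i < j → Submodule.span K {a i, a j} ≠ Submodule.span K {b i, b j})
    (h₁₂ : m₁₂ ∈ Submodule.span K {a 0, a 1}) (h₁₂' : m₁₂ ∈ Submodule.span K {b 0, b 1})
    (h₁₃ : m₁₃ ∈ Submodule.span K {a 0, a 2}) (h₁₃' : m₁₃ ∈ Submodule.span K {b 0, b 2})
    (h₂₃ : m₂₃ ∈ Submodule.span K {a 1, a 2}) (h₂₃' : m₂₃ ∈ Submodule.span K {b 1, b 2}) :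
    ¬ LinearIndependent K ![m₁₂, m₁₃, m₂₃] := by
  intro hli
  choose α β h using fun i => Submodule.mem_span_pair.1 (hsab i)
  obtain ⟨c, rfl⟩ := side_intersection_eq_smul hs (ha 0 1 (by decide)) (hb 0 1 (by decide))
    (hne 0 1 (by decide)) (h 0) (h 1) h₁₂ h₁₂'
  obtain ⟨d, rfl⟩ := side_intersection_eq_smul hs (ha 0 2 (by decide)) (hb 0 2 (by decide))
    (hne 0 2 (by decide)) (h 0) (h 2) h₁₃ h₁₃'
  obtain ⟨e, rfl⟩ := side_intersection_eq_smul hs (ha 1 2 (by decide)) (hb 1 2 (by decide))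
    (hne 1 2 (by decide)) (h 1) (h 2) h₂₃ h₂₃'
  have hc : c ≠ 0 := by rintro rfl; exact hli.ne_zero 0 (by simp)
  have hd : d ≠ 0 := by rintro rfl; exact hli.ne_zero 1 (by simp)
  have he : e ≠ 0 := by rintro rfl; exact hli.ne_zero 2 (by simp)
  -- After the scalars are divided out, the relation is `(α₀a₀ - α₁a₁) - (α₀a₀ - α₂a₂) + (α₁a₁ -
  -- α₂a₂) = 0`.
  have := Fintype.linearIndependent_iff.1 hli ![c⁻¹, -d⁻¹, e⁻¹] (by
    simp only [Fin.sum_univ_three, Matrix.cons_val_zero, Matrix.cons_val_one, Matrix.cons_val]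
    simp only [smul_smul, neg_mul, inv_mul_cancel₀ hc, inv_mul_cancel₀ hd, inv_mul_cancel₀ he]
    module) 0
  simp [hc] at this

/-- Three dependent vectors, the first of which is not zero, are in the span of the first and
one of the others. -/
theorem exists_pair_of_not_linearIndependent {x y z : V} (hx : x ≠ 0)
    (h : ¬ LinearIndependent K ![x, y, z]) :
    (∃ c d : K, y = c • x ∧ z = d • x) ∨
      (LinearIndependent K ![x, y] ∧ z ∈ Submodule.span K {x, y}) ∨
      (LinearIndependent K ![x, z] ∧ y ∈ Submodule.span K {x, z}) := by
  have key : ∀ {y z : V}, ¬ LinearIndependent K ![x, y, z] → LinearIndependent K ![x, y] →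
      z ∈ Submodule.span K {x, y} := by
    intro y z h hy
    by_contra hz
    apply h
    -- `finCons` puts the new vector in front, so the family `z, x, y` is rotated back afterwards.
    have := LinearIndependent.finCons hy (x := z) (by rwa [Matrix.range_cons_cons_empty])
    have h2 := this.comp (![1, 2, 0] : Fin 3 → Fin 3) (by decide)
    convert h2 using 1
    ext i
    fin_cases i <;> rfl
  by_cases hy : LinearIndependent K ![x, y]
  · exact Or.inr (Or.inl ⟨hy, key h hy⟩)
  by_cases hz : LinearIndependent K ![x, z]
  · refine Or.inr (Or.inr ⟨hz, key (fun h' => h ?_) hz⟩)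
    have h2 := h'.comp (![0, 2, 1] : Fin 3 → Fin 3) (by decide)
    convert h2 using 1
    ext i
    fin_cases i <;> rfl
  · rw [LinearIndependent.pair_iff' hx] at hy hz
    push Not at hy hz
    obtain ⟨c, hc⟩ := hy
    obtain ⟨d, hd⟩ := hz
    exact Or.inl ⟨c, d, hc.symm, hd.symm⟩

end VectorDesargues

/-! ### Transport to an incidence geometry -/

section IncidenceDesargues

variable {X : Type} {K V : Type*} [Field K] [AddCommGroup V] [Module K V]

/-- If the joins of points of `T` are mapped by `φ` into projective lines, and intersecting joins
that are mapped into the same line are equal, then the theorem of Desargues for vectors applies. -/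
theorem DesarguesConfiguration.not_linearIndependent {Surf T : Set X} {L : Set (Set X)}
    {A B : Fin 3 → X} {S M₁₂ M₁₃ M₂₃ : X} (φ : X → V)
    (hT : Surf ⊆ T) (hφ : ∀ P, φ P ≠ 0)
    (hjoin : ∀ P ∈ T, ∀ Q ∈ T, ∀ g, IsJoin L P Q g → LinearIndependent K ![φ P, φ Q] ∧
      ∀ R ∈ g, R ∈ T ∧ φ R ∈ Submodule.span K {φ P, φ Q})
    (hsep : ∀ P ∈ T, ∀ Q ∈ T, ∀ P' ∈ T, ∀ Q' ∈ T, ∀ g h, IsJoin L P Q g → IsJoin L P' Q' h →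
      Submodule.span K {φ P, φ Q} = Submodule.span K {φ P', φ Q'} → (∃ M, M ∈ g ∧ M ∈ h) → g = h)
    (H : DesarguesConfiguration Surf L A B S M₁₂ M₁₃ M₂₃) :
    (M₁₂ ∈ T ∧ M₁₃ ∈ T ∧ M₂₃ ∈ T) ∧ ¬ LinearIndependent K ![φ M₁₂, φ M₁₃, φ M₂₃] := by
  obtain ⟨⟨⟨hA, -⟩, ⟨hB, -⟩, hAS, hBS, hS, hAB⟩, h12, h13, h23⟩ := H
  have hside : ∀ {i j M}, IsSideIntersection L A B i j M → M ∈ T ∧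
      φ M ∈ Submodule.span K {φ (A i), φ (A j)} ∧ φ M ∈ Submodule.span K {φ (B i), φ (B j)} ∧
      Submodule.span K {φ (A i), φ (A j)} ≠ Submodule.span K {φ (B i), φ (B j)} := by
    rintro i j M ⟨g, h, hg, hh, hne, hMg, hMh⟩
    have h1 := (hjoin _ (hT (hAS i)) _ (hT (hAS j)) g hg).2 M hMg
    have h2 := (hjoin _ (hT (hBS i)) _ (hT (hBS j)) h hh).2 M hMh
    -- The point `M` is common to both sides, so equal image lines would make the sides equal.
    exact ⟨h1.1, h1.2, h2.2, fun e => hne (hsep _ (hT (hAS i)) _ (hT (hAS j)) _ (hT (hBS i)) _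
      (hT (hBS j)) g h hg hh e ⟨M, hMg, hMh⟩)⟩
  refine ⟨⟨(hside h12).1, (hside h13).1, (hside h23).1⟩, ?_⟩
  refine not_linearIndependent_of_perspective (a := fun i => φ (A i)) (b := fun i => φ (B i))
    (hφ S) (fun i j hij => ?_) (fun i j hij => ?_) (fun i => ?_) ?_
    (hside h12).2.1 (hside h12).2.2.1 (hside h13).2.1 (hside h13).2.2.1
    (hside h23).2.1 (hside h23).2.2.1
  · obtain ⟨g, hg⟩ := hA i j hij
    exact (hjoin _ (hT (hAS i)) _ (hT (hAS j)) g hg).1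
  · obtain ⟨g, hg⟩ := hB i j hij
    exact (hjoin _ (hT (hBS i)) _ (hT (hBS j)) g hg).1
  · obtain ⟨g, hg, hSg⟩ := hAB i
    exact ((hjoin _ (hT (hAS i)) _ (hT (hBS i)) g hg).2 S hSg).2
  · intro i j hij
    fin_cases i <;> fin_cases j <;> first
      | exact absurd hij (by decide)
      | exact (hside h12).2.2.2
      | exact (hside h13).2.2.2
      | exact (hside h23).2.2.2

end IncidenceDesargues

/-! ### Geometries straightened by an affine chart -/

section AffineDesargues

variable {X : Type} {E : Type*} [AddCommGroup E] [Module ℝ E]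

theorem linearIndependent_one_pair {v w : E} (h : v ≠ w) :
    LinearIndependent ℝ ![((1 : ℝ), v), (1, w)] := by
  rw [LinearIndependent.pair_iff' (by simp)]
  rintro c hc
  simp only [Prod.smul_mk, smul_eq_mul, mul_one, Prod.mk.injEq] at hc
  obtain ⟨rfl, hc⟩ := hc
  exact h (by simpa using hc)

theorem one_mem_span_pair_iff {v w x : E} :
    ((1 : ℝ), x) ∈ Submodule.span ℝ {((1 : ℝ), v), (1, w)} ↔ ∃ t : ℝ, x = v + t • (w - v) := by
  rw [Submodule.mem_span_pair]
  constructor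
  · rintro ⟨a, b, h⟩
    simp only [Prod.smul_mk, smul_eq_mul, mul_one, Prod.mk_add_mk, Prod.mk.injEq] at h
    obtain ⟨h1, rfl⟩ := h
    obtain rfl : a = 1 - b := by linarith
    exact ⟨b, by module⟩
  · rintro ⟨t, rfl⟩
    refine ⟨1 - t, t, ?_⟩
    simp only [Prod.smul_mk, smul_eq_mul, mul_one, Prod.mk_add_mk, Prod.mk.injEq]
    exact ⟨by ring, by module⟩

/-- The theorem of Desargues for a geometry on `T` that is mapped by `φ` to a part of an
affine space in such a way that the curves correspond to the straight lines. -/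
theorem DesarguesConfiguration.onOneCurve_of_affine [Nontrivial E] {Surf T : Set X}
    {L : Set (Set X)} {A B : Fin 3 → X} {S M₁₂ M₁₃ M₂₃ : X} (φ : X → E) (hT : Surf ⊆ T)
    (hφ : Set.InjOn φ T)
    (hline : ∀ g ∈ L, ∀ P ∈ T, ∀ Q ∈ T, P ∈ g → Q ∈ g → P ≠ Q →
      ∃ v d : E, ∀ R, R ∈ g ↔ R ∈ T ∧ ∃ t : ℝ, φ R = v + t • d)
    (hex : ∀ P ∈ T, ∀ d : E, d ≠ 0 → ∃ g ∈ L, ∀ R ∈ T, (∃ t : ℝ, φ R = φ P + t • d) → R ∈ g)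
    (H : DesarguesConfiguration Surf L A B S M₁₂ M₁₃ M₂₃) : OnOneCurve L M₁₂ M₁₃ M₂₃ := by
  -- Lifting `x` to `(1, x)` turns affine lines into planes of `ℝ × E`; a curve is then exactly the
  -- part of `T` in the plane of two of its points.
  have key : ∀ P ∈ T, ∀ Q ∈ T, ∀ g ∈ L, P ∈ g → Q ∈ g → P ≠ Q →
      ∀ R, R ∈ g ↔ R ∈ T ∧ ((1 : ℝ), φ R) ∈ Submodule.span ℝ {((1 : ℝ), φ P), (1, φ Q)} := by
    intro P hP Q hQ g hg hPg hQg hPQ R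
    obtain ⟨v, d, h⟩ := hline g hg P hP Q hQ hPg hQg hPQ
    obtain ⟨-, p, hp⟩ := (h P).1 hPg
    obtain ⟨-, q, hq⟩ := (h Q).1 hQg
    rw [h, one_mem_span_pair_iff, hp, hq]
    have hpq : q - p ≠ 0 := by
      rintro h0
      rw [sub_eq_zero] at h0
      exact hPQ (hφ hP hQ (by rw [hp, hq, h0]))
    refine and_congr_right fun _ => ⟨?_, ?_⟩
    · rintro ⟨t, ht⟩
      refine ⟨(t - p) / (q - p), ?_⟩
      have : t = p + (t - p) / (q - p) * (q - p) := by field_simp; ring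
      rw [ht]
      conv_lhs => rw [this]
      module
    · rintro ⟨t, ht⟩
      exact ⟨p + t * (q - p), by rw [ht]; module⟩
  obtain ⟨⟨h1, h2, h3⟩, hdep⟩ := H.not_linearIndependent (K := ℝ) (fun P => ((1 : ℝ), φ P)) hT
    (fun P => by simp) (by
      rintro P hP Q hQ g ⟨hne, hg, hPg, hQg, -⟩
      exact ⟨linearIndependent_one_pair fun e => hne (hφ hP hQ e),
        fun R hR => (key P hP Q hQ g hg hPg hQg hne R).1 hR⟩) (by
      rintro P hP Q hQ P' hP' Q' hQ' g h ⟨hne, hg, hPg, hQg, -⟩ ⟨hne', hh, hPh, hQh, -⟩ e -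
      ext R
      rw [key P hP Q hQ g hg hPg hQg hne, key P' hP' Q' hQ' h hh hPh hQh hne', e])
  have conv : ∀ {x : E} {c : ℝ}, ((1 : ℝ), x) = c • ((1 : ℝ), φ M₁₂) → x = φ M₁₂ := by
    intro x c h
    simp only [Prod.smul_mk, smul_eq_mul, mul_one, Prod.mk.injEq] at h
    obtain ⟨rfl, h⟩ := h
    simpa using h
  have ne : ∀ {x : E}, LinearIndependent ℝ ![((1 : ℝ), φ M₁₂), (1, x)] → x - φ M₁₂ ≠ 0 := by
    intro x h h0
    rw [sub_eq_zero] at h0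
    subst h0
    exact one_ne_zero (LinearIndependent.pair_iff.1 h 1 (-1) (by simp)).1
  rcases exists_pair_of_not_linearIndependent (by simp) hdep with ⟨c, d, hc, hd⟩ | ⟨hl, hm⟩ |
    ⟨hl, hm⟩
  -- The three intersection points have the same image, so a curve through it in any direction
  -- serves.
  · obtain ⟨v, hv⟩ := exists_ne (0 : E)
    obtain ⟨g, hg, h⟩ := hex _ h1 v hv
    exact ⟨g, hg, h _ h1 ⟨0, by simp⟩, h _ h2 ⟨0, by simp [conv hc]⟩, h _ h3 ⟨0, by simp [conv hd]⟩⟩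
  · obtain ⟨g, hg, h⟩ := hex _ h1 _ (ne hl)
    exact ⟨g, hg, h _ h1 ⟨0, by simp⟩, h _ h2 ⟨1, by simp⟩, h _ h3 (one_mem_span_pair_iff.1 hm)⟩
  · obtain ⟨g, hg, h⟩ := hex _ h1 _ (ne hl)
    exact ⟨g, hg, h _ h1 ⟨0, by simp⟩, h _ h2 (one_mem_span_pair_iff.1 hm), h _ h3 ⟨1, by simp⟩⟩

end AffineDesargues

/-! ### Surfaces whose curves lie over the lines of a base -/

section GeneralType

variable {Y Z : Type} {V : Type*} [AddCommGroup V] [Module ℝ V]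

theorem exists_plane_of_mem_pair [FiniteDimensional ℝ V] (hV : Module.finrank ℝ V = 3) {v : V}
    (hv : v ≠ 0) (w : V) :
    ∃ W : Submodule ℝ V, Module.finrank ℝ W = 2 ∧ v ∈ W ∧ w ∈ W := by
  have aux : ∀ u, LinearIndependent ℝ ![v, u] →
      ∃ W : Submodule ℝ V, Module.finrank ℝ W = 2 ∧ v ∈ W ∧ u ∈ W := fun u hu =>
    ⟨_, finrank_span_pair_of_linearIndependent hu, Submodule.subset_span (by simp),
      Submodule.subset_span (by simp)⟩
  by_cases hw : LinearIndependent ℝ ![v, w]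
  · exact aux w hw
  rw [LinearIndependent.pair_iff' hv] at hw
  push Not at hw
  obtain ⟨c, rfl⟩ := hw
  obtain ⟨u, hu⟩ : ∃ u, u ∉ Submodule.span ℝ {v} := by
    by_contra! h
    have h1 : Submodule.span ℝ {v} = ⊤ := Submodule.eq_top_iff'.2 h
    have h2 := finrank_span_singleton (K := ℝ) hv
    rw [h1, finrank_top, hV] at h2
    omega
  obtain ⟨W, hW, hvW, -⟩ := aux u (by
    rw [LinearIndependent.pair_iff' hv]
    rintro c rfl
    exact hu (Submodule.smul_mem _ _ (Submodule.mem_span_singleton_self v)))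
  exact ⟨W, hW, hvW, W.smul_mem c hvW⟩

/-- The theorem of Desargues on a surface of a product with base `Y`, if the connecting
curves are the parts of the surface over the lines of the base, the lines of the base are
the plane sections, and the surface has three points over no line. -/
theorem DesarguesConfiguration.onOneCurve_of_base [FiniteDimensional ℝ V]
    (hV : Module.finrank ℝ V = 3) {Surf : Set (Y × Z)} {L : Set (Set (Y × Z))}
    {lines : Set (Set Y)} {A B : Fin 3 → Y × Z} {S M₁₂ M₁₃ M₂₃ : Y × Z} (ψ : Y → V)
    (hψ : ∀ y, ψ y ≠ 0)
    (hlines : ∀ c, c ∈ lines ↔ ∃ W : Submodule ℝ V, Module.finrank ℝ W = 2 ∧ (∃ y, ψ y ∈ W) ∧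
      c = {y | ψ y ∈ W})
    (hL : ∀ g, g ∈ L ↔ ∃ c ∈ lines, g = Surf ∩ Prod.fst ⁻¹' c)
    (hA : LinearIndependent ℝ fun i => ψ (A i).1)
    (H : DesarguesConfiguration Surf L A B S M₁₂ M₁₃ M₂₃) : OnOneCurve L M₁₂ M₁₃ M₂₃ := by
  have hL' : ∀ g, g ∈ L ↔ ∃ W : Submodule ℝ V, Module.finrank ℝ W = 2 ∧ (∃ y, ψ y ∈ W) ∧
      ∀ P, P ∈ g ↔ P ∈ Surf ∧ ψ P.1 ∈ W := by
    intro g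
    rw [hL]
    constructor
    · rintro ⟨c, hc, rfl⟩
      obtain ⟨W, hW, hy, rfl⟩ := (hlines c).1 hc
      exact ⟨W, hW, hy, fun P => Iff.rfl⟩
    · rintro ⟨W, hW, hy, h⟩
      exact ⟨_, (hlines _).2 ⟨W, hW, hy, rfl⟩, Set.ext h⟩
  have hAS := H.1.2.2.1
  -- If the projections of `P` and `Q` were proportional, every plane through one would contain the
  -- other. By uniqueness of the join, the curve over each such plane is `g`. Choosing the plane
  -- through a vertex `A i` puts all vertices over the single plane `W`, against their independence.
  have hind : ∀ P Q g, IsJoin L P Q g → LinearIndependent ℝ ![ψ P.1, ψ Q.1] := by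
    rintro P Q g ⟨-, hg, hP, hQ, huniq⟩
    obtain ⟨W, hW, -, h⟩ := (hL' g).1 hg
    by_contra hli
    rw [LinearIndependent.pair_iff' (hψ _)] at hli
    push Not at hli
    obtain ⟨c, hc⟩ := hli
    have hAW : ∀ i, ψ (A i).1 ∈ W := by
      intro i
      obtain ⟨W', hW', h1, h2⟩ := exists_plane_of_mem_pair hV (hψ P.1) (ψ (A i).1)
      have e := huniq {R | R ∈ Surf ∧ ψ R.1 ∈ W'} ((hL' _).2 ⟨W', hW', ⟨_, h1⟩, fun _ => Iff.rfl⟩)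
        ⟨((h P).1 hP).1, h1⟩ ⟨((h Q).1 hQ).1, hc ▸ W'.smul_mem c h1⟩
      have : A i ∈ g := e ▸ ⟨hAS i, h2⟩
      exact ((h _).1 this).2
    have h3 := finrank_span_eq_card hA
    have h4 := Submodule.finrank_mono (Submodule.span_le.2 (Set.range_subset_iff.2 hAW))
    rw [h3, hW] at h4
    simp at h4
  have hmem : ∀ P Q g, IsJoin L P Q g → ∀ R, R ∈ g ↔ R ∈ Surf ∧
      ψ R.1 ∈ Submodule.span ℝ {ψ P.1, ψ Q.1} := by
    rintro P Q g hj R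
    have hli := hind P Q g hj
    obtain ⟨-, hg, hP, hQ, -⟩ := hj
    obtain ⟨W, hW, -, h⟩ := (hL' g).1 hg
    have : Submodule.span ℝ {ψ P.1, ψ Q.1} = W := by
      apply Submodule.eq_of_le_of_finrank_eq
      · rw [Submodule.span_le]
        rintro x (rfl | rfl)
        · exact ((h P).1 hP).2
        · exact ((h Q).1 hQ).2
      · rw [hW, finrank_span_pair_of_linearIndependent hli]
    rw [h, this]
  have hsep : ∀ P ∈ Surf, ∀ Q ∈ Surf, ∀ P' ∈ Surf, ∀ Q' ∈ Surf, ∀ g h, IsJoin L P Q g →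
      IsJoin L P' Q' h → Submodule.span ℝ {ψ P.1, ψ Q.1} = Submodule.span ℝ {ψ P'.1, ψ Q'.1} →
      (∃ M, M ∈ g ∧ M ∈ h) → g = h := by
    intro P _ Q _ P' _ Q' _ g h hg hh e _
    ext R
    rw [hmem P Q g hg, hmem P' Q' h hh, e]
  obtain ⟨⟨h1, h2, h3⟩, hdep⟩ := DesarguesConfiguration.not_linearIndependent (K := ℝ)
    (T := Surf) (fun P => ψ P.1) (Set.Subset.refl Surf) (fun P => hψ P.1)
    (fun P _ Q _ g hg => ⟨hind P Q g hg, fun R hR => (hmem P Q g hg R).1 hR⟩) hsep H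
  have fin : ∀ W : Submodule ℝ V, Module.finrank ℝ W = 2 → ψ M₁₂.1 ∈ W → ψ M₁₃.1 ∈ W →
      ψ M₂₃.1 ∈ W → OnOneCurve L M₁₂ M₁₃ M₂₃ := fun W hW e1 e2 e3 =>
    ⟨{R | R ∈ Surf ∧ ψ R.1 ∈ W}, (hL' _).2 ⟨W, hW, ⟨_, e1⟩, fun _ => Iff.rfl⟩, ⟨h1, e1⟩, ⟨h2, e2⟩,
      ⟨h3, e3⟩⟩
  rcases exists_pair_of_not_linearIndependent (hψ _) hdep with ⟨c, d, hc, hd⟩ | ⟨hl, hm⟩ |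
    ⟨hl, hm⟩
  · obtain ⟨W, hW, hx, -⟩ := exists_plane_of_mem_pair hV (hψ M₁₂.1) 0
    exact fin W hW hx (hc ▸ W.smul_mem c hx) (hd ▸ W.smul_mem d hx)
  · exact fin _ (finrank_span_pair_of_linearIndependent hl) (Submodule.subset_span (by simp))
      (Submodule.subset_span (by simp)) hm
  · exact fin _ (finrank_span_pair_of_linearIndependent hl) (Submodule.subset_span (by simp)) hm
      (Submodule.subset_span (by simp))

end GeneralType

/-! ### Translation curves of Sol and their straightening -/

/-- The primitive of `exp (k * t)` that vanishes at `0`. -/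
def expPrimitive (k t : ℝ) : ℝ := if k = 0 then t else (Real.exp (k * t) - 1) / k

theorem expPrimitive_zero (k : ℝ) : expPrimitive k 0 = 0 := by
  simp [expPrimitive]

theorem hasDerivAt_expPrimitive (k t : ℝ) :
    HasDerivAt (expPrimitive k) (Real.exp (k * t)) t := by
  by_cases hk : k = 0
  · have : expPrimitive k = fun t => t := by
      ext t
      simp [expPrimitive, hk]
    rw [this, hk]
    simpa using hasDerivAt_id' t
  · have : expPrimitive k = fun t => (Real.exp (k * t) - 1) / k := by
      ext t
      simp [expPrimitive, hk]
    rw [this]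
    refine ((((hasDerivAt_id' t).const_mul k).exp.sub_const 1).div_const k).congr_deriv ?_
    field_simp

theorem mul_expPrimitive (k t : ℝ) : k * expPrimitive k t = Real.exp (k * t) - 1 := by
  by_cases hk : k = 0
  · simp [hk]
  · simp only [expPrimitive, hk, if_false]
    field_simp

/-- The integral of `exp (-k * s)` over `[0, t]` is `-expPrimitive k (-t)`. Multiplication by `exp
(k * t)`, as in the second coordinate of `Sol.chart`, brings it to the common parameter
`expPrimitive k t`. -/
theorem expPrimitive_neg (k t : ℝ) :
    -expPrimitive k (-t) * Real.exp (k * t) = expPrimitive k t := by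
  by_cases hk : k = 0
  · simp [expPrimitive, hk]
  · simp only [expPrimitive, hk, if_false, mul_neg, Real.exp_neg]
    have := Real.exp_ne_zero (k * t)
    field_simp
    ring

/-- The condition `0 < 1 + k * s` keeps the point with parameter `s` on a straight line inside the
half-space that is the image of `Sol.chart`. For `k ≠ 0` one solves `exp (k * t) = 1 + k * s`. -/
theorem exists_expPrimitive_eq {k s : ℝ} (h : 0 < 1 + k * s) : ∃ t, expPrimitive k t = s := by
  by_cases hk : k = 0
  · exact ⟨s, by simp [expPrimitive, hk]⟩
  · refine ⟨Real.log (1 + k * s) / k, ?_⟩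
    simp only [expPrimitive, hk, if_false]
    rw [mul_div_cancel₀ _ hk, Real.exp_log h]
    field_simp
    ring

namespace Sol

/-- The translation motion with initial point `P`. -/
def motion (u : Fin 3 → ℝ) (P : Sol) (t : ℝ) : Sol :=
  ![P 0 + u 0 * Real.exp (-P 2) * -expPrimitive (u 2) (-t),
    P 1 + u 1 * Real.exp (P 2) * expPrimitive (u 2) t, P 2 + u 2 * t]

theorem motion_zero (u : Fin 3 → ℝ) (P : Sol) : motion u P 0 = P := by
  ext i
  fin_cases i <;> simp [motion, expPrimitive_zero]

theorem hasDerivAt_motion_zero (u : Fin 3 → ℝ) (P : Sol) (t : ℝ) :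
    HasDerivAt (fun t => motion u P t 0) (u 0 * Real.exp (-(P 2 + u 2 * t))) t := by
  have h := ((((hasDerivAt_expPrimitive (u 2) (-t)).comp t (hasDerivAt_neg t)).neg).const_mul
    (u 0 * Real.exp (-P 2))).const_add (P 0)
  refine (h.congr_deriv ?_)
  rw [neg_add, Real.exp_add]
  simp only [mul_neg, mul_one, neg_neg]
  ring

theorem hasDerivAt_motion_one (u : Fin 3 → ℝ) (P : Sol) (t : ℝ) :
    HasDerivAt (fun t => motion u P t 1) (u 1 * Real.exp (P 2 + u 2 * t)) t := by
  have h := ((hasDerivAt_expPrimitive (u 2) t).const_mul (u 1 * Real.exp (P 2))).const_add (P 1)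
  refine (h.congr_deriv ?_)
  rw [Real.exp_add]
  ring

theorem hasDerivAt_motion_two (u : Fin 3 → ℝ) (P : Sol) (t : ℝ) :
    HasDerivAt (fun t => motion u P t 2) (u 2) t := by
  exact (((hasDerivAt_id' t).const_mul (u 2)).const_add (P 2)).congr_deriv (mul_one _)

theorem isTranslationMotion_motion (u : Fin 3 → ℝ) (P : Sol) :
    IsTranslationMotion u (motion u P) := by
  intro t
  rw [hasDerivAt_pi]
  intro i
  fin_cases i
  · exact hasDerivAt_motion_zero u P t
  · exact hasDerivAt_motion_one u P t
  · exact hasDerivAt_motion_two u P t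

theorem eq_of_hasDerivAt_eq {f g f' : ℝ → ℝ} (hf : ∀ t, HasDerivAt f (f' t) t)
    (hg : ∀ t, HasDerivAt g (f' t) t) (h : f 0 = g 0) (t : ℝ) : f t = g t := by
  have h1 : ∀ t, HasDerivAt (fun t => f t - g t) 0 t := fun t =>
    ((hf t).sub (hg t)).congr_deriv (sub_self _)
  have := is_const_of_deriv_eq_zero (fun t => (h1 t).differentiableAt) (fun t => (h1 t).deriv) t 0
  simp only [h, sub_self] at this
  linarith

/-- The system is triangular: the third coordinate is linear in time, and then the derivatives of
the other two are known functions of time. -/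
theorem IsTranslationMotion.eq_motion {u : Fin 3 → ℝ} {γ : ℝ → Sol}
    (h : IsTranslationMotion u γ) (t : ℝ) : γ t = motion u (γ 0) t := by
  have h' := fun t => hasDerivAt_pi.1 (h t)
  have e2 : ∀ t, γ t 2 = γ 0 2 + u 2 * t := fun t =>
    eq_of_hasDerivAt_eq (fun t => h' t 2) (hasDerivAt_motion_two u (γ 0)) (by rw [motion_zero]) t
  ext i
  fin_cases i
  · refine eq_of_hasDerivAt_eq (f := fun t => γ t 0) (fun t => ?_)
      (hasDerivAt_motion_zero u (γ 0)) (by rw [motion_zero]) t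
    rw [← e2]
    exact h' t 0
  · refine eq_of_hasDerivAt_eq (f := fun t => γ t 1) (fun t => ?_)
      (hasDerivAt_motion_one u (γ 0)) (by rw [motion_zero]) t
    rw [← e2]
    exact h' t 1
  · exact e2 t

/-- Coordinates in which the translation curves are straight. -/
def chart (P : Sol) : Fin 3 → ℝ := ![Real.exp (P 2), P 0 * Real.exp (P 2), P 1]

theorem chart_injective : Function.Injective chart := by
  intro P Q h
  have h0 : Real.exp (P 2) = Real.exp (Q 2) := congrFun h 0
  have h1 : P 0 * Real.exp (P 2) = Q 0 * Real.exp (Q 2) := congrFun h 1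
  have h2 : P 1 = Q 1 := congrFun h 2
  rw [h0] at h1
  ext i
  fin_cases i
  · exact mul_right_cancel₀ (Real.exp_ne_zero _) h1
  · exact h2
  · exact Real.exp_injective h0

/-- The direction, in the straightening chart, of the translation curve through `P`. -/
def direction (P : Sol) (u : Fin 3 → ℝ) : Fin 3 → ℝ :=
  ![u 2 * Real.exp (P 2), u 0 + u 2 * (P 0 * Real.exp (P 2)), u 1 * Real.exp (P 2)]

theorem chart_motion (u : Fin 3 → ℝ) (P : Sol) (t : ℝ) :
    chart (motion u P t) = chart P + expPrimitive (u 2) t • direction P u := by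
  have h1 := mul_expPrimitive (u 2) t
  have h2 := expPrimitive_neg (u 2) t
  have h3 : Real.exp (-P 2) * Real.exp (P 2) = 1 := by rw [← Real.exp_add]; simp
  ext i
  fin_cases i
  · simp [chart, motion, direction, Real.exp_add]
    linear_combination -Real.exp (P 2) * h1
  · simp [chart, motion, direction, Real.exp_add]
    linear_combination (-P 0 * Real.exp (P 2)) * h1 + u 0 * h2 -
      u 0 * expPrimitive (u 2) (-t) * Real.exp (u 2 * t) * h3
  · simp [chart, motion, direction]
    ring

/-- A motion covers all points of its straight line with positive first chart coordinate, and every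
`chart R` has that property because this coordinate is an exponential. -/
theorem mem_range_motion_iff (u : Fin 3 → ℝ) (P R : Sol) :
    R ∈ Set.range (motion u P) ↔ ∃ s : ℝ, chart R = chart P + s • direction P u := by
  constructor
  · rintro ⟨t, rfl⟩
    exact ⟨_, chart_motion u P t⟩
  · rintro ⟨s, hs⟩
    obtain ⟨t, rfl⟩ : ∃ t, expPrimitive (u 2) t = s := by
      apply exists_expPrimitive_eq
      have h : Real.exp (R 2) = Real.exp (P 2) + s * (u 2 * Real.exp (P 2)) := congrFun hs 0
      have h1 := Real.exp_pos (R 2)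
      have h2 := Real.exp_pos (P 2)
      rw [h] at h1
      by_contra hn
      nlinarith
    exact ⟨t, chart_injective (by rw [chart_motion, hs])⟩

theorem desargues {A B : Fin 3 → Sol} {S M₁₂ M₁₃ M₂₃ : Sol}
    (H : DesarguesConfiguration (surface A) curves A B S M₁₂ M₁₃ M₂₃) :
    OnOneCurve curves M₁₂ M₁₃ M₂₃ := by
  refine H.onOneCurve_of_affine (T := Set.univ) chart (Set.subset_univ _)
    chart_injective.injOn ?_ ?_
  · rintro g ⟨u, -, γ, hγ, rfl⟩ P - Q - - - -
    refine ⟨chart (γ 0), direction (γ 0) u, fun R => ?_⟩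
    rw [show γ = motion u (γ 0) from funext hγ.eq_motion, mem_range_motion_iff, motion_zero]
    simp
  · intro P _ d hd
    have hP := Real.exp_ne_zero (P 2)
    -- This is the solution `u` of `direction P u = d`.
    set u : Fin 3 → ℝ := ![d 1 - d 0 * P 0, d 2 / Real.exp (P 2), d 0 / Real.exp (P 2)] with hu
    have hdir : direction P u = d := by
      ext i
      fin_cases i
      · simp [direction, hu]
      · simp [direction, hu]
        field_simp
        ring
      · simp [direction, hu]
    refine ⟨Set.range (motion u P), ⟨u, ?_, _, isTranslationMotion_motion u P, rfl⟩, ?_⟩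
    · intro h0
      apply hd
      rw [← hdir, h0]
      ext i
      fin_cases i <;> simp [direction]
    · rintro R - ⟨t, ht⟩
      rw [mem_range_motion_iff, hdir]
      exact ⟨t, ht⟩

end Sol

/-! ### Dimension counts for planes -/

/-- A plane that contains two independent vectors is spanned by them. -/
theorem span_pair_eq_of_finrank {V : Type*} [AddCommGroup V] [Module ℝ V] [FiniteDimensional ℝ V]
    {W : Submodule ℝ V} {v w : V} (hW : Module.finrank ℝ W ≤ 2) (h : LinearIndependent ℝ ![v, w])
    (hv : v ∈ W) (hw : w ∈ W) : Submodule.span ℝ {v, w} = W := by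
  apply Submodule.eq_of_le_of_finrank_le
  · rw [Submodule.span_le]
    rintro x (rfl | rfl)
    · exact hv
    · exact hw
  · rwa [finrank_span_pair_of_linearIndependent h]

theorem finrank_span_le_two {V : Type*} [AddCommGroup V] [Module ℝ V] [FiniteDimensional ℝ V]
    {v : Fin 3 → V} (h : ¬ LinearIndependent ℝ v) :
    Module.finrank ℝ (Submodule.span ℝ (Set.range v)) ≤ 2 := by
  have h1 := finrank_range_le_card (R := ℝ) v
  rw [Set.finrank, Fintype.card_fin] at h1
  rw [linearIndependent_iff_card_eq_finrank_span, Fintype.card_fin, Set.finrank] at h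
  omega

theorem exists_mem_of_finrank_eq_two {V : Type*} [AddCommGroup V] [Module ℝ V]
    {W : Submodule ℝ V} (hW : Module.finrank ℝ W = 2) (v : V) :
    ∃ w ∈ W, ∀ c : ℝ, w ≠ c • v := by
  by_contra! h
  have h1 : W ≤ Submodule.span ℝ {v} := fun w hw => by
    obtain ⟨c, rfl⟩ := h w hw
    exact Submodule.smul_mem _ _ (Submodule.mem_span_singleton_self v)
  have h2 := Submodule.finrank_mono h1
  have h3 := finrank_span_le_card (R := ℝ) ({v} : Set V)
  rw [Set.toFinset_singleton, Finset.card_singleton] at h3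
  omega

/-! ### The hyperbolic plane -/

theorem lorentz_comm (x y : Fin 3 → ℝ) : lorentz x y = lorentz y x := by
  simp only [lorentz]
  ring

theorem lorentz_add_right (x y z : Fin 3 → ℝ) :
    lorentz x (y + z) = lorentz x y + lorentz x z := by
  simp only [lorentz, Pi.add_apply]
  ring

theorem lorentz_smul_right (c : ℝ) (x y : Fin 3 → ℝ) : lorentz x (c • y) = c * lorentz x y := by
  simp only [lorentz, Pi.smul_apply, smul_eq_mul]
  ring

theorem lorentz_add_left (x y z : Fin 3 → ℝ) :
    lorentz (x + y) z = lorentz x z + lorentz y z := by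
  simp only [lorentz, Pi.add_apply]
  ring

theorem lorentz_smul_left (c : ℝ) (x y : Fin 3 → ℝ) : lorentz (c • x) y = c * lorentz x y := by
  simp only [lorentz, Pi.smul_apply, smul_eq_mul]
  ring

theorem lorentz_combination {p e : Fin 3 → ℝ} (h1 : lorentz p p = -1) (h2 : lorentz p e = 0)
    (h3 : lorentz e e = 1) (a b c d : ℝ) :
    lorentz (a • p + b • e) (c • p + d • e) = -(a * c) + b * d := by
  simp only [lorentz_add_left, lorentz_add_right, lorentz_smul_left, lorentz_smul_right,
    lorentz_comm e p, h1, h2, h3]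
  ring

namespace H2

theorem ne_zero (p : H2) : p.1 ≠ 0 := fun h => by
  have := p.2.2
  rw [h] at this
  exact lt_irrefl _ this

/-- By Cauchy–Schwarz the spatial product is smaller in absolute value than `p 0 * q 0`, which is
positive on the upper sheet. -/
theorem lorentz_neg (p q : H2) : lorentz p.1 q.1 < 0 := by
  obtain ⟨p, hp, hp0⟩ := p
  obtain ⟨q, hq, hq0⟩ := q
  rw [lorentz] at hp hq ⊢
  have h : (p 1 * q 1 + p 2 * q 2) ^ 2 < (p 0 * q 0) ^ 2 := by
    have e1 : p 0 ^ 2 = 1 + p 1 ^ 2 + p 2 ^ 2 := by linarith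
    have e2 : q 0 ^ 2 = 1 + q 1 ^ 2 + q 2 ^ 2 := by linarith
    rw [mul_pow, e1, e2]
    nlinarith [sq_nonneg (p 1 * q 2 - p 2 * q 1), sq_nonneg (p 1), sq_nonneg (p 2),
      sq_nonneg (q 1), sq_nonneg (q 2)]
  have := lt_of_pow_lt_pow_left₀ 2 (by positivity) h
  linarith

/-- The orthogonal complement of a timelike vector is spacelike: `p 0 * w 0` is a spatial product,
and Cauchy–Schwarz bounds it. -/
theorem lorentz_pos {p : H2} {w : Fin 3 → ℝ} (h : lorentz p.1 w = 0) (hw : w ≠ 0) :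
    0 < lorentz w w := by
  obtain ⟨p, hp, hp0⟩ := p
  rw [lorentz] at hp h ⊢
  have e1 : p 0 ^ 2 = 1 + p 1 ^ 2 + p 2 ^ 2 := by linarith
  have e2 : p 0 * w 0 = p 1 * w 1 + p 2 * w 2 := by linarith
  have h1 : p 0 ^ 2 * w 0 ^ 2 ≤ (p 0 ^ 2 - 1) * (w 1 ^ 2 + w 2 ^ 2) := by
    rw [← mul_pow, e2, e1]
    nlinarith [sq_nonneg (p 1 * w 2 - p 2 * w 1)]
  by_contra hn
  have h2 : w 1 ^ 2 + w 2 ^ 2 ≤ w 0 ^ 2 := by linarith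
  have h3 : w 1 ^ 2 + w 2 ^ 2 ≤ 0 := by
    nlinarith [mul_le_mul_of_nonneg_left h2 (sq_nonneg (p 0))]
  have w1 : w 1 = 0 := pow_eq_zero_iff two_ne_zero |>.1 (by nlinarith [sq_nonneg (w 1), sq_nonneg (w 2)])
  have w2 : w 2 = 0 := pow_eq_zero_iff two_ne_zero |>.1 (by nlinarith [sq_nonneg (w 1), sq_nonneg (w 2)])
  have w0 : w 0 = 0 := by
    rw [w1, w2] at e2
    simpa [hp0.ne'] using e2
  apply hw
  ext i
  fin_cases i
  · exact w0
  · exact w1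
  · exact w2

theorem IsUnitTangent.linearIndependent {p : H2} {e : Fin 3 → ℝ} (h : IsUnitTangent p e) :
    LinearIndependent ℝ ![p.1, e] := by
  rw [LinearIndependent.pair_iff' p.ne_zero]
  rintro c rfl
  have h1 := h.1
  rw [lorentz_smul_right, p.2.1] at h1
  obtain rfl : c = 0 := by linarith
  have h2 := h.2
  simp [lorentz] at h2

/-- A point `a • p + b • e` of the hyperboloid satisfies `a ^ 2 = 1 + b ^ 2`. Its negative product
with `p` gives `a > 0`, so `a` is the hyperbolic cosine of `arsinh b`. -/
theorem IsUnitTangent.mem_span_iff {p : H2} {e : Fin 3 → ℝ} (h : IsUnitTangent p e) (x : H2) :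
    x.1 ∈ Submodule.span ℝ {p.1, e} ↔ ∃ t : ℝ, x.1 = Real.cosh t • p.1 + Real.sinh t • e := by
  rw [Submodule.mem_span_pair]
  constructor
  · rintro ⟨a, b, hx⟩
    have h1 := x.2.1
    rw [← hx, lorentz_combination p.2.1 h.1 h.2] at h1
    have h2 := lorentz_neg p x
    rw [← hx, lorentz_add_right, lorentz_smul_right, lorentz_smul_right, p.2.1, h.1] at h2
    refine ⟨Real.arsinh b, ?_⟩
    rw [Real.sinh_arsinh, Real.cosh_arsinh, show 1 + b ^ 2 = a ^ 2 by linarith,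
      Real.sqrt_sq (by linarith), hx]
  · rintro ⟨t, ht⟩
    exact ⟨_, _, ht.symm⟩

theorem exists_isUnitTangent {p : H2} {W : Submodule ℝ (Fin 3 → ℝ)}
    (hW : Module.finrank ℝ W = 2) (hp : p.1 ∈ W) : ∃ e ∈ W, IsUnitTangent p e := by
  obtain ⟨w, hw, hwp⟩ := exists_mem_of_finrank_eq_two hW p.1
  -- Orthogonal projection; the sign is plus because `p` has Lorentz square `-1`.
  set v := w + lorentz p.1 w • p.1 with hv
  have h1 : lorentz p.1 v = 0 := by
    rw [hv, lorentz_add_right, lorentz_smul_right, p.2.1]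
    ring
  have h2 : v ≠ 0 := fun h0 => hwp (-lorentz p.1 w) (by
    rw [neg_smul]
    exact eq_neg_of_add_eq_zero_left h0)
  have h3 := lorentz_pos h1 h2
  refine ⟨(√(lorentz v v))⁻¹ • v, W.smul_mem _ (W.add_mem hw (W.smul_mem _ hp)), ?_, ?_⟩
  · rw [lorentz_smul_right, h1, mul_zero]
  · rw [lorentz_smul_right, lorentz_smul_left]
    have := Real.mul_self_sqrt h3.le
    have h4 := (Real.sqrt_pos.2 h3).ne'
    field_simp
    rw [sq]
    exact this.symm

theorem mem_lines_iff (c : Set H2) : c ∈ lines ↔ ∃ W : Submodule ℝ (Fin 3 → ℝ),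
    Module.finrank ℝ W = 2 ∧ (∃ y : H2, y.1 ∈ W) ∧ c = {y | y.1 ∈ W} := by
  constructor
  · rintro ⟨p, e, h, rfl⟩
    refine ⟨_, finrank_span_pair_of_linearIndependent h.linearIndependent,
      ⟨p, Submodule.subset_span (by simp)⟩, ?_⟩
    ext x
    exact (h.mem_span_iff x).symm
  · rintro ⟨W, hW, ⟨p, hp⟩, rfl⟩
    obtain ⟨e, he, h⟩ := exists_isUnitTangent hW hp
    refine ⟨p, e, h, ?_⟩
    ext x
    change x.1 ∈ W ↔ ∃ t : ℝ, _
    rw [← h.mem_span_iff, span_pair_eq_of_finrank hW.le h.linearIndependent hp he]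

theorem linearIndependent_of_ne {p q : H2} (h : p ≠ q) : LinearIndependent ℝ ![p.1, q.1] := by
  rw [LinearIndependent.pair_iff' p.ne_zero]
  intro c hc
  have h1 := q.2.1
  have h2 := q.2.2
  rw [← hc, lorentz_smul_right, lorentz_smul_left, p.2.1] at h1
  rw [← hc, Pi.smul_apply, smul_eq_mul] at h2
  have hc0 : 0 < c := pos_of_mul_pos_left h2 p.2.2.le
  obtain rfl : c = 1 := by nlinarith
  exact h (Subtype.ext (by simpa using hc))

/-- The unit tangent vectors of a geodesic line, at an arbitrary point of it. -/
theorem IsUnitTangent.eq_or_eq_neg {p q : H2} {e f : Fin 3 → ℝ} {t : ℝ} (he : IsUnitTangent p e)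
    (hf : IsUnitTangent q f) (hq : q.1 = Real.cosh t • p.1 + Real.sinh t • e)
    (hfe : f ∈ Submodule.span ℝ {p.1, e}) :
    ∃ k : ℝ, (k = 1 ∨ k = -1) ∧ f = k • (Real.sinh t • p.1 + Real.cosh t • e) := by
  obtain ⟨a, b, rfl⟩ := Submodule.mem_span_pair.1 hfe
  have h1 := hf.1
  have h2 := hf.2
  have h3 := Real.cosh_sq t
  rw [hq, lorentz_combination p.2.1 he.1 he.2] at h1
  rw [lorentz_combination p.2.1 he.1 he.2] at h2
  have ea : (b * Real.cosh t - a * Real.sinh t) * Real.sinh t = a := by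
    linear_combination Real.cosh t * h1 + a * h3
  have eb : (b * Real.cosh t - a * Real.sinh t) * Real.cosh t = b := by
    linear_combination Real.sinh t * h1 + b * h3
  -- The factor is the Lorentz product of `f` with the unit tangent of the line at `q`.
  refine ⟨b * Real.cosh t - a * Real.sinh t, ?_, ?_⟩
  · apply mul_self_eq_one_iff.1
    linear_combination h2 + b * eb - a * ea
  · rw [smul_add, smul_smul, smul_smul, ea, eb]

end H2

/-! ### H² × ℝ -/

namespace H2R

theorem mem_curves_iff_of_generalType {A : Fin 3 → H2R} (hA : GeneralType A) (g : Set H2R) :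
    g ∈ curves A ↔ ∃ c ∈ H2.lines, g = surface A ∩ Prod.fst ⁻¹' c := by
  constructor
  · rintro (h | h)
    · exact h.2
    · exact absurd hA h.1
  · exact fun h => Or.inl ⟨hA, h⟩

theorem curves_eq_of_not_generalType {A : Fin 3 → H2R} (hA : ¬ GeneralType A) :
    curves A = translationCurves := by
  ext g
  constructor
  · rintro (h | h)
    · exact absurd h.1 hA
    · exact h.2
  · exact fun h => Or.inr ⟨hA, h⟩

theorem surface_eq_of_not_generalType {A : Fin 3 → H2R} (hA : ¬ GeneralType A) :
    surface A = {P | P.1.1 ∈ Submodule.span ℝ (Set.range fun i => (A i).1.1)} := by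
  ext g
  constructor
  · rintro (h | h)
    · exact absurd h.1 hA
    · exact h.2
  · exact fun h => Or.inr ⟨hA, h⟩

/-- The isometry of a vertical plane, over the line with the unit tangent vector `e` at some
point, with the Euclidean plane. -/
def chart (e : Fin 3 → ℝ) (P : H2R) : ℝ × ℝ := (Real.arsinh (lorentz P.1.1 e), P.2)

theorem chart_fst_eq {p : H2} {e : Fin 3 → ℝ} (he : H2.IsUnitTangent p e)
    {P : H2R} {t : ℝ} (hP : P.1.1 = Real.cosh t • p.1 + Real.sinh t • e) :
    (chart e P).1 = t := by
  simp only [chart, hP, lorentz_add_left, lorentz_smul_left, he.1, he.2]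
  simp

theorem eq_of_mem_span {p : H2} {e : Fin 3 → ℝ} (he : H2.IsUnitTangent p e)
    {P : H2R} (hP : P.1.1 ∈ Submodule.span ℝ {p.1, e}) :
    P.1.1 = Real.cosh (chart e P).1 • p.1 + Real.sinh (chart e P).1 • e := by
  obtain ⟨t, ht⟩ := (he.mem_span_iff P.1).1 hP
  rw [chart_fst_eq he ht, ht]

theorem injOn_chart {p : H2} {e : Fin 3 → ℝ} (he : H2.IsUnitTangent p e) :
    Set.InjOn (chart e) {P | P.1.1 ∈ Submodule.span ℝ {p.1, e}} := by
  intro P hP Q hQ h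
  have h2 : (chart e P).2 = (chart e Q).2 := congrArg Prod.snd h
  refine Prod.ext (Subtype.ext ?_) h2
  rw [eq_of_mem_span he hP, eq_of_mem_span he hQ, h]

/-- A translation curve with two points in a vertical plane is a straight line of the plane. -/
theorem exists_line {p : H2} {e : Fin 3 → ℝ} (he : H2.IsUnitTangent p e)
    {g : Set H2R} (hg : g ∈ translationCurves) {P Q : H2R}
    (hP : P.1.1 ∈ Submodule.span ℝ {p.1, e}) (hQ : Q.1.1 ∈ Submodule.span ℝ {p.1, e})
    (hPg : P ∈ g) (hQg : Q ∈ g) (hPQ : P ≠ Q) :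
    ∃ v d : ℝ × ℝ, ∀ R, R ∈ g ↔ R.1.1 ∈ Submodule.span ℝ {p.1, e} ∧
      ∃ t : ℝ, chart e R = v + t • d := by
  obtain ⟨O, f, a, b, hf, hab, rfl⟩ := hg
  obtain ⟨r, hr1, hr2⟩ := hPg
  obtain ⟨s, hs1, hs2⟩ := hQg
  have hrs : s - r ≠ 0 := by
    intro h0
    obtain rfl : s = r := by linarith
    exact hPQ (Prod.ext (Subtype.ext (hr1.trans hs1.symm)) (hr2.trans hs2.symm))
  -- The curve has base coordinate linear in time. The sign `k` compares `f` with the orientation of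
  -- the line; for a fibre (`a = 0`) it is irrelevant and set to `0`.
  obtain ⟨k, hO, hk⟩ : ∃ k : ℝ, O.1.1 ∈ Submodule.span ℝ {p.1, e} ∧
      ∀ t, Real.cosh (t * a) • O.1.1 + Real.sinh (t * a) • f =
        Real.cosh ((chart e O).1 + t * (k * a)) • p.1 +
          Real.sinh ((chart e O).1 + t * (k * a)) • e := by
    by_cases ha : a = 0
    · have hO : O.1.1 ∈ Submodule.span ℝ {p.1, e} := by
        rw [hr1, ha] at hP
        simpa using hP
      refine ⟨0, hO, fun t => ?_⟩
      have := eq_of_mem_span he hO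
      simpa [ha] using this
    -- `P` and `Q` are combinations of `O` and `f` with determinant `sinh ((s - r) * a)`. Cramer's
    -- rule recovers `O` and `f`, which therefore lie in the plane.
    · have hd : Real.sinh ((s - r) * a) ≠ 0 := by
        rw [Ne, Real.sinh_eq_zero]
        exact mul_ne_zero hrs ha
      have hO : O.1.1 ∈ Submodule.span ℝ {p.1, e} := by
        have : O.1.1 = (Real.sinh ((s - r) * a))⁻¹ •
            (Real.sinh (s * a) • P.1.1 - Real.sinh (r * a) • Q.1.1) := by
          rw [eq_inv_smul_iff₀ hd, hr1, hs1, sub_mul, Real.sinh_sub]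
          module
        rw [this]
        exact Submodule.smul_mem _ _ (Submodule.sub_mem _ (Submodule.smul_mem _ _ hP)
          (Submodule.smul_mem _ _ hQ))
      have hf' : f ∈ Submodule.span ℝ {p.1, e} := by
        have : f = (Real.sinh ((s - r) * a))⁻¹ •
            (Real.cosh (r * a) • Q.1.1 - Real.cosh (s * a) • P.1.1) := by
          rw [eq_inv_smul_iff₀ hd, hr1, hs1, sub_mul, Real.sinh_sub]
          module
        rw [this]
        exact Submodule.smul_mem _ _ (Submodule.sub_mem _ (Submodule.smul_mem _ _ hQ)
          (Submodule.smul_mem _ _ hP))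
      have hO' := eq_of_mem_span he hO
      obtain ⟨k, hk, hfk⟩ := he.eq_or_eq_neg hf hO' hf'
      refine ⟨k, hO, fun t => ?_⟩
      have hk' : Real.cosh (t * (k * a)) = Real.cosh (t * a) ∧
          Real.sinh (t * (k * a)) = k * Real.sinh (t * a) := by
        rcases hk with rfl | rfl <;> simp
      rw [Real.cosh_add, Real.sinh_add, hk'.1, hk'.2]
      nth_rw 1 [hO', hfk]
      module
  refine ⟨chart e O, (k * a, b), fun R => ⟨?_, ?_⟩⟩
  · rintro ⟨t, h1, h2⟩
    rw [hk] at h1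
    refine ⟨(he.mem_span_iff R.1).2 ⟨_, h1⟩, t, Prod.ext ?_ h2⟩
    exact chart_fst_eq he h1
  · rintro ⟨hR, t, ht⟩
    refine ⟨t, ?_, congrArg Prod.snd ht⟩
    rw [hk, eq_of_mem_span he hR, ht]
    rfl

theorem exists_translationCurve {p : H2} {e : Fin 3 → ℝ} (he : H2.IsUnitTangent p e)
    {P : H2R} (hP : P.1.1 ∈ Submodule.span ℝ {p.1, e}) {d : ℝ × ℝ}
    (hd : d ≠ 0) : ∃ g ∈ translationCurves, ∀ R : H2R, R.1.1 ∈ Submodule.span ℝ {p.1, e} →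
      (∃ t : ℝ, chart e R = chart e P + t • d) → R ∈ g := by
  set τ := (chart e P).1 with hτ
  have hP' := eq_of_mem_span he hP
  rw [← hτ] at hP'
  have h3 := Real.cosh_sq τ
  refine ⟨_, ⟨P, Real.sinh τ • p.1 + Real.cosh τ • e, d.1, d.2, ⟨?_, ?_⟩, hd, rfl⟩, ?_⟩
  · rw [hP', lorentz_combination p.2.1 he.1 he.2]
    ring
  · rw [lorentz_combination p.2.1 he.1 he.2]
    linear_combination h3
  · rintro R hR ⟨t, ht⟩
    refine ⟨t, ?_, congrArg Prod.snd ht⟩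
    have h1 : (chart e R).1 = τ + t * d.1 := congrArg Prod.fst ht
    rw [eq_of_mem_span he hR, hP', h1, Real.cosh_add, Real.sinh_add]
    module

/-- Otherwise all vertices lie on one fibre, which is the translation curve with velocity `(0, 1)`.
-/
theorem exists_fst_ne {A : Fin 3 → H2R} (hA : ¬ ∃ g ∈ translationCurves, ∀ i, A i ∈ g) :
    ∃ i, (A 0).1 ≠ (A i).1 := by
  by_contra! h
  obtain ⟨W, hW, hp, -⟩ := exists_plane_of_mem_pair (V := Fin 3 → ℝ) (by simp) (A 0).1.ne_zero 0
  obtain ⟨e, -, he⟩ := H2.exists_isUnitTangent hW hp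
  refine hA ⟨_, ⟨A 0, e, 0, 1, he, by simp, rfl⟩, fun i => ⟨(A i).2 - (A 0).2, ?_, ?_⟩⟩
  · simp [h i]
  · simp

theorem desargues {A B : Fin 3 → H2R} {S M₁₂ M₁₃ M₂₃ : H2R}
    (H : DesarguesConfiguration (surface A) (curves A) A B S M₁₂ M₁₃ M₂₃) :
    OnOneCurve (curves A) M₁₂ M₁₃ M₂₃ := by
  by_cases hA : GeneralType A
  · exact H.onOneCurve_of_base (V := Fin 3 → ℝ) (by simp) Subtype.val H2.ne_zero H2.mem_lines_iff
      (mem_curves_iff_of_generalType hA) hA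
  rw [curves_eq_of_not_generalType hA] at H ⊢
  obtain ⟨i, hi⟩ := exists_fst_ne H.1.1.2
  set W := Submodule.span ℝ (Set.range fun i => (A i).1.1) with hW
  have hAW : ∀ i, (A i).1.1 ∈ W := fun i => Submodule.subset_span ⟨i, rfl⟩
  -- Dependence bounds the dimension by two; two vertices over different base points make it exactly
  -- two.
  have hW2 : Module.finrank ℝ W = 2 := by
    have hspan : Submodule.span ℝ {(A 0).1.1, (A i).1.1} = W :=
      span_pair_eq_of_finrank (finrank_span_le_two hA) (H2.linearIndependent_of_ne hi)
        (hAW 0) (hAW i)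
    rw [← hspan]
    exact finrank_span_pair_of_linearIndependent (H2.linearIndependent_of_ne hi)
  obtain ⟨e, heW, he⟩ := H2.exists_isUnitTangent hW2 (hAW 0)
  have hS : surface A = {P | P.1.1 ∈ Submodule.span ℝ {(A 0).1.1, e}} := by
    rw [surface_eq_of_not_generalType hA,
      span_pair_eq_of_finrank hW2.le he.linearIndependent (hAW 0) heW]
  exact H.onOneCurve_of_affine (chart e) hS.le (injOn_chart he)
    (fun g hg P hP Q hQ hPg hQg hPQ => exists_line he hg hP hQ hPg hQg hPQ)
    (fun P hP d hd => exists_translationCurve he hP hd)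

end H2R

/-! ### The sphere and S² × ℝ -/

theorem inner_combination {p e : E3} (h1 : ‖p‖ = 1) (h2 : inner ℝ p e = 0) (h3 : ‖e‖ = 1)
    (a b c d : ℝ) : inner ℝ (a • p + b • e) (c • p + d • e) = a * c + b * d := by
  have h4 : inner ℝ e p = 0 := by rw [real_inner_comm, h2]
  simp only [inner_add_left, inner_add_right, real_inner_smul_left, real_inner_smul_right,
    real_inner_self_eq_norm_sq, h1, h2, h3, h4]
  ring

theorem exists_cos_sin {a b : ℝ} (h : a * a + b * b = 1) :
    ∃ t : ℝ, a = Real.cos t ∧ b = Real.sin t := by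
  have hn : ‖(⟨a, b⟩ : ℂ)‖ = 1 := by
    rw [Complex.norm_def, Complex.normSq_mk, h, Real.sqrt_one]
  have h0 : (⟨a, b⟩ : ℂ) ≠ 0 := fun e => by simp [e] at hn
  refine ⟨Complex.arg ⟨a, b⟩, ?_, ?_⟩
  · rw [Complex.cos_arg h0, hn, div_one]
  · rw [Complex.sin_arg, hn, div_one]

namespace S2

theorem norm_eq (p : S2) : ‖p.1‖ = 1 := by
  simp

theorem ne_zero (p : S2) : p.1 ≠ 0 := fun h => by
  simpa [h] using p.norm_eq

theorem inner_self (p : S2) : inner ℝ p.1 p.1 = (1 : ℝ) := by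
  rw [real_inner_self_eq_norm_sq, p.norm_eq, one_pow]

theorem IsUnitTangent.linearIndependent {p : S2} {e : E3} (h : IsUnitTangent p e) :
    LinearIndependent ℝ ![p.1, e] := by
  rw [LinearIndependent.pair_iff' p.ne_zero]
  rintro c rfl
  have h1 := h.1
  rw [real_inner_smul_right, p.inner_self, mul_one] at h1
  have h2 := h.2
  simp [h1] at h2

theorem IsUnitTangent.mem_span_iff {p : S2} {e : E3} (h : IsUnitTangent p e) (x : S2) :
    x.1 ∈ Submodule.span ℝ {p.1, e} ↔ ∃ t : ℝ, x.1 = Real.cos t • p.1 + Real.sin t • e := by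
  rw [Submodule.mem_span_pair]
  constructor
  · rintro ⟨a, b, hx⟩
    have h1 := x.inner_self
    rw [← hx, inner_combination p.norm_eq h.1 h.2] at h1
    obtain ⟨t, rfl, rfl⟩ := exists_cos_sin h1
    exact ⟨t, hx.symm⟩
  · rintro ⟨t, ht⟩
    exact ⟨_, _, ht.symm⟩

theorem exists_isUnitTangent {p : S2} {W : Submodule ℝ E3}
    (hW : Module.finrank ℝ W = 2) (hp : p.1 ∈ W) : ∃ e ∈ W, IsUnitTangent p e := by
  obtain ⟨w, hw, hwp⟩ := exists_mem_of_finrank_eq_two hW p.1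
  set v := w - (inner ℝ p.1 w : ℝ) • p.1 with hv
  have h1 : inner ℝ p.1 v = 0 := by
    rw [hv, inner_sub_right, real_inner_smul_right, p.inner_self]
    ring
  have h2 : v ≠ 0 := fun h0 => hwp (inner ℝ p.1 w) (sub_eq_zero.1 h0)
  refine ⟨‖v‖⁻¹ • v, W.smul_mem _ (W.sub_mem hw (W.smul_mem _ hp)), ?_, ?_⟩
  · rw [real_inner_smul_right, h1, mul_zero]
  · rw [norm_smul, norm_inv, norm_norm, inv_mul_cancel₀ (norm_ne_zero_iff.2 h2)]

theorem mem_lines_iff (c : Set S2) : c ∈ lines ↔ ∃ W : Submodule ℝ E3,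
    Module.finrank ℝ W = 2 ∧ (∃ y : S2, y.1 ∈ W) ∧ c = {y | y.1 ∈ W} := by
  constructor
  · rintro ⟨p, e, h, rfl⟩
    refine ⟨_, finrank_span_pair_of_linearIndependent h.linearIndependent,
      ⟨p, Submodule.subset_span (by simp)⟩, ?_⟩
    ext x
    exact (h.mem_span_iff x).symm
  · rintro ⟨W, hW, ⟨p, hp⟩, rfl⟩
    obtain ⟨e, he, h⟩ := exists_isUnitTangent hW hp
    refine ⟨p, e, h, ?_⟩
    ext x
    change x.1 ∈ W ↔ ∃ t : ℝ, _
    rw [← h.mem_span_iff, span_pair_eq_of_finrank hW.le h.linearIndependent hp he]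

theorem IsUnitTangent.eq_or_eq_neg {n : S2} {e f : E3} (he : IsUnitTangent n e)
    (hf : IsUnitTangent n f) (hfe : f ∈ Submodule.span ℝ {n.1, e}) :
    ∃ k : ℝ, (k = 1 ∨ k = -1) ∧ f = k • e := by
  obtain ⟨a, b, rfl⟩ := Submodule.mem_span_pair.1 hfe
  have h1 := hf.1
  rw [inner_add_right, real_inner_smul_right, real_inner_smul_right, n.inner_self, he.1] at h1
  obtain rfl : a = 0 := by linarith
  have h2 := hf.2
  rw [zero_smul, zero_add, norm_smul, he.2, mul_one, Real.norm_eq_abs] at h2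
  exact ⟨b, eq_or_eq_neg_of_abs_eq h2, by simp⟩

end S2

namespace S2R

/-- The development of an open vertical half-plane with middle point `n` to the strip of width
`π`; `e` is the direction of the base circle at `n`. -/
def chart (e : E3) (P : S2R) : ℝ × ℝ := (Real.arcsin (inner ℝ e P.1.1), P.2)

/-- The open half of the vertical surface over the great circle with tangent `e` at `n`. -/
def openHalf (n : S2) (e : E3) : Set S2R :=
  {P | P.1.1 ∈ Submodule.span ℝ {n.1, e} ∧ 0 < inner ℝ n.1 P.1.1}

theorem chart_fst_eq {n : S2} {e : E3} (he : S2.IsUnitTangent n e) {P : S2R} {t : ℝ}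
    (ht : |t| < Real.pi / 2) (hP : P.1.1 = Real.cos t • n.1 + Real.sin t • e) :
    (chart e P).1 = t := by
  have h4 : inner ℝ e n.1 = 0 := by rw [real_inner_comm, he.1]
  simp only [chart, hP, inner_add_right, real_inner_smul_right, h4,
    real_inner_self_eq_norm_sq, he.2]
  rw [abs_lt] at ht
  rw [mul_zero, zero_add, one_pow, mul_one, Real.arcsin_sin ht.1.le ht.2.le]

theorem mem_openHalf_iff {n : S2} {e : E3} (he : S2.IsUnitTangent n e) {P : S2R} :
    P ∈ openHalf n e ↔ |(chart e P).1| < Real.pi / 2 ∧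
      P.1.1 = Real.cos (chart e P).1 • n.1 + Real.sin (chart e P).1 • e := by
  constructor
  · rintro ⟨h1, h2⟩
    obtain ⟨a, b, hx⟩ := Submodule.mem_span_pair.1 h1
    have h3 := P.1.inner_self
    rw [← hx, inner_combination n.norm_eq he.1 he.2] at h3
    rw [← hx, inner_add_right, real_inner_smul_right, real_inner_smul_right, n.inner_self,
      he.1] at h2
    have ha : 0 < a := by linarith
    have hb : (chart e P).1 = Real.arcsin b := by
      have h4 : inner ℝ e n.1 = 0 := by rw [real_inner_comm, he.1]
      simp only [chart, ← hx, inner_add_right, real_inner_smul_right, h4,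
        real_inner_self_eq_norm_sq, he.2]
      simp
    rw [hb, Real.cos_arcsin, Real.sin_arcsin (by nlinarith) (by nlinarith),
      show 1 - b ^ 2 = a ^ 2 by linarith, Real.sqrt_sq ha.le, hx, abs_lt]
    exact ⟨⟨Real.neg_pi_div_two_lt_arcsin.2 (by nlinarith), Real.arcsin_lt_pi_div_two.2
      (by nlinarith)⟩, rfl⟩
  · rintro ⟨h1, h2⟩
    refine ⟨(he.mem_span_iff P.1).2 ⟨_, h2⟩, ?_⟩
    rw [h2, inner_add_right, real_inner_smul_right, real_inner_smul_right, n.inner_self, he.1]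
    rw [abs_lt] at h1
    have := Real.cos_pos_of_mem_Ioo ⟨h1.1, h1.2⟩
    linarith

theorem injOn_chart {n : S2} {e : E3} (he : S2.IsUnitTangent n e) :
    Set.InjOn (chart e) (openHalf n e) := by
  intro P hP Q hQ h
  have h2 : (chart e P).2 = (chart e Q).2 := congrArg Prod.snd h
  refine Prod.ext (Subtype.ext ?_) h2
  rw [((mem_openHalf_iff he).1 hP).2, ((mem_openHalf_iff he).1 hQ).2, h]

/-- An arc is parametrized by signed arc length from `n` over the whole interval of length `π`, so
its chart image is a full section of the strip by a line. -/
theorem exists_line {n : S2} {e : E3} (he : S2.IsUnitTangent n e) {g : Set S2R} (hg : g ∈ arcs n)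
    {P Q : S2R} (hP : P ∈ openHalf n e) (hQ : Q ∈ openHalf n e) (hPg : P ∈ g) (hQg : Q ∈ g)
    (hPQ : P ≠ Q) :
    ∃ v d : ℝ × ℝ, ∀ R, R ∈ g ↔ R ∈ openHalf n e ∧ ∃ t : ℝ, chart e R = v + t • d := by
  rcases hg with ⟨f, z, w, hf, rfl⟩ | ⟨x, -, rfl⟩
  · obtain ⟨r, hr, hr1, hr2⟩ := hPg
    obtain ⟨s, hs, hs1, hs2⟩ := hQg
    -- A point of the arc not over `n` determines the direction `f`. Of two different points of the
    -- arc at least one is not over `n`.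
    have key : ∀ (R : S2R) (r : ℝ), R ∈ openHalf n e → |r| < Real.pi / 2 → r ≠ 0 →
        R.1.1 = Real.cos r • n.1 + Real.sin r • f → f ∈ Submodule.span ℝ {n.1, e} := by
      intro R r hR hr hr0 h
      have hsin : Real.sin r ≠ 0 := by
        rw [abs_lt] at hr
        rwa [Ne, Real.sin_eq_zero_iff_of_lt_of_lt (by linarith [Real.pi_pos])
          (by linarith [Real.pi_pos])]
      have : f = (Real.sin r)⁻¹ • (R.1.1 - Real.cos r • n.1) := by
        rw [eq_inv_smul_iff₀ hsin, h]
        module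
      rw [this]
      exact Submodule.smul_mem _ _ (Submodule.sub_mem _ hR.1
        (Submodule.smul_mem _ _ (Submodule.subset_span (by simp))))
    have hfe : f ∈ Submodule.span ℝ {n.1, e} := by
      by_cases hr0 : r = 0
      · by_cases hs0 : s = 0
        · exact absurd (Prod.ext (Subtype.ext (by rw [hr1, hs1, hr0, hs0]))
            (by rw [hr2, hs2, hr0, hs0])) hPQ
        · exact key Q s hQ hs hs0 hs1
      · exact key P r hP hr hr0 hr1
    obtain ⟨k, hk, rfl⟩ := he.eq_or_eq_neg hf hfe
    have hk' : ∀ t, Real.cos (t * k) = Real.cos t ∧ Real.sin (t * k) = Real.sin t * k ∧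
        |t * k| = |t| := by
      rcases hk with rfl | rfl <;> simp
    have hpt : ∀ t, Real.cos t • n.1 + Real.sin t • k • e =
        Real.cos (t * k) • n.1 + Real.sin (t * k) • e := by
      intro t
      rw [(hk' t).1, (hk' t).2.1, smul_smul]
    refine ⟨(0, z), (k, w), fun R => ⟨?_, ?_⟩⟩
    · rintro ⟨t, ht, h1, h2⟩
      rw [hpt] at h1
      rw [← (hk' t).2.2] at ht
      have h3 := chart_fst_eq he ht h1
      exact ⟨(mem_openHalf_iff he).2 (by rw [h3]; exact ⟨ht, h1⟩), t,
        Prod.ext (by simp [h3]) (by simpa [chart] using h2)⟩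
    · rintro ⟨hR, t, ht⟩
      have h3 : (chart e R).1 = t * k := by simp [ht]
      have h4 : R.2 = z + t * w := congrArg Prod.snd ht
      obtain ⟨h1, h2⟩ := (mem_openHalf_iff he).1 hR
      rw [h3] at h1 h2
      rw [(hk' t).2.2] at h1
      exact ⟨t, h1, by rw [h2, hpt], h4⟩
  · have hx : P.1 = x := hPg
    subst hx
    refine ⟨((chart e P).1, 0), (0, 1), fun R => ⟨?_, ?_⟩⟩
    · intro hR
      have hR' : R.1 = P.1 := hR
      refine ⟨?_, R.2, Prod.ext (by simp [chart, hR']) (by simp [chart])⟩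
      rw [openHalf, Set.mem_ofPred_eq, hR']
      exact hP
    · rintro ⟨hR, t, ht⟩
      have h3 : (chart e R).1 = (chart e P).1 := by simp [ht]
      apply Subtype.ext
      rw [((mem_openHalf_iff he).1 hR).2, ((mem_openHalf_iff he).1 hP).2, h3]

theorem exists_arc {n : S2} {e : E3} (he : S2.IsUnitTangent n e) {P : S2R} (hP : P ∈ openHalf n e)
    (d : ℝ × ℝ) : ∃ g ∈ arcs n, ∀ R ∈ openHalf n e,
      (∃ t : ℝ, chart e R = chart e P + t • d) → R ∈ g := by
  by_cases hd1 : d.1 = 0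
  · refine ⟨_, Or.inr ⟨P.1, hP.2, rfl⟩, ?_⟩
    rintro R hR ⟨t, ht⟩
    have h3 : (chart e R).1 = (chart e P).1 := by simp [ht, hd1]
    apply Subtype.ext
    rw [((mem_openHalf_iff he).1 hR).2, ((mem_openHalf_iff he).1 hP).2, h3]
  -- The slope of the line in the strip, and its height over the middle point `n`.
  · refine ⟨_, Or.inl ⟨e, P.2 - (chart e P).1 * (d.2 / d.1), d.2 / d.1, he, rfl⟩, ?_⟩
    rintro R hR ⟨t, ht⟩
    obtain ⟨h1, h2⟩ := (mem_openHalf_iff he).1 hR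
    refine ⟨(chart e R).1, h1, h2, ?_⟩
    have h3 : (chart e R).1 = (chart e P).1 + t * d.1 := congrArg Prod.fst ht
    have h4 : R.2 = P.2 + t * d.2 := congrArg Prod.snd ht
    rw [h3, h4]
    field_simp
    ring

theorem desargues_of_generalType {A B : Fin 3 → S2R} {S M₁₂ M₁₃ M₂₃ : S2R} (hA : GeneralType A)
    (H : DesarguesConfiguration (surface A) (curves A) A B S M₁₂ M₁₃ M₂₃) :
    OnOneCurve (curves A) M₁₂ M₁₃ M₂₃ :=
  H.onOneCurve_of_base (V := E3) (by simp) Subtype.val S2.ne_zero S2.mem_lines_iff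
    (fun _ => Iff.rfl) hA

/-- The point `n` is not assumed to lie in the plane of the vertices. Two vertices are over
different base points, since otherwise a fibre would contain all three. The arc joining these two
passes over `n`, which forces `n` and the direction of the arc into that plane. -/
theorem desargues_of_fibreType {A B : Fin 3 → S2R} {n : S2} {S M₁₂ M₁₃ M₂₃ : S2R}
    (hA : ¬ GeneralType A)
    (H : DesarguesConfiguration (halfPlane A n) (arcs n) A B S M₁₂ M₁₃ M₂₃) :
    OnOneCurve (arcs n) M₁₂ M₁₃ M₂₃ := by
  have hAS := H.1.2.2.1
  obtain ⟨i, hi⟩ : ∃ i, (A 0).1 ≠ (A i).1 := by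
    by_contra! h
    exact H.1.1.2 ⟨_, Or.inr ⟨(A 0).1, (hAS 0).2, rfl⟩, fun i => (h i).symm⟩
  obtain ⟨g, -, hg, h0, h1, -⟩ := H.1.1.1 0 i (by rintro rfl; exact hi rfl)
  rcases hg with ⟨e, z, w, he, rfl⟩ | ⟨x, -, rfl⟩
  swap
  · exact absurd (Eq.trans h0 h1.symm) hi
  obtain ⟨r, hr, hr1, -⟩ := h0
  obtain ⟨s, hs, hs1, -⟩ := h1
  rw [abs_lt] at hr hs
  have hd : Real.sin (s - r) ≠ 0 := by
    rw [Ne, Real.sin_eq_zero_iff_of_lt_of_lt (by linarith) (by linarith), sub_eq_zero]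
    rintro rfl
    exact hi (Subtype.ext (hr1.trans hs1.symm))
  have hn : n.1 = (Real.sin (s - r))⁻¹ • (Real.sin s • (A 0).1.1 - Real.sin r • (A i).1.1) := by
    rw [eq_inv_smul_iff₀ hd, hr1, hs1, Real.sin_sub]
    module
  have hf : e = (Real.sin (s - r))⁻¹ • (Real.cos r • (A i).1.1 - Real.cos s • (A 0).1.1) := by
    rw [eq_inv_smul_iff₀ hd, hr1, hs1, Real.sin_sub]
    module
  set W := Submodule.span ℝ (Set.range fun i => (A i).1.1) with hW
  have hAW : ∀ i, (A i).1.1 ∈ W := fun i => Submodule.subset_span ⟨i, rfl⟩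
  have hspan : Submodule.span ℝ {n.1, e} = W := by
    refine span_pair_eq_of_finrank (finrank_span_le_two hA) he.linearIndependent ?_ ?_
    · rw [hn]
      exact W.smul_mem _ (W.sub_mem (W.smul_mem _ (hAW _)) (W.smul_mem _ (hAW _)))
    · rw [hf]
      exact W.smul_mem _ (W.sub_mem (W.smul_mem _ (hAW _)) (W.smul_mem _ (hAW _)))
  have hT : halfPlane A n ⊆ openHalf n e := by
    rintro P ⟨hP, hP'⟩
    exact ⟨hspan ▸ hP, hP'⟩
  exact H.onOneCurve_of_affine (chart e) hT (injOn_chart he)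
    (fun g hg P hP Q hQ hPg hQg hPQ => exists_line he hg hP hQ hPg hQg hPQ)
    (fun P hP d _ => exists_arc he hP d)

end S2R

/-! ### The solutions of `C' = -δ S`, `S' = C` -/

/-- The solution with `C 0 = 1` of `C' = -δ S`, `S' = C`. -/
def genCos (δ t : ℝ) : ℝ :=
  if 0 < δ then Real.cos (√δ * t) else if δ < 0 then Real.cosh (√(-δ) * t) else 1

/-- The solution with `S 0 = 0` of `C' = -δ S`, `S' = C`. -/
def genSin (δ t : ℝ) : ℝ :=
  if 0 < δ then Real.sin (√δ * t) / √δ else if δ < 0 then Real.sinh (√(-δ) * t) / √(-δ) else t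

theorem genCos_zero (δ : ℝ) : genCos δ 0 = 1 := by
  simp [genCos]

theorem genSin_zero (δ : ℝ) : genSin δ 0 = 0 := by
  simp [genSin]

theorem hasDerivAt_genCos (δ t : ℝ) : HasDerivAt (genCos δ) (-δ * genSin δ t) t := by
  rcases lt_trichotomy δ 0 with h | rfl | h
  · have hc : genCos δ = fun t => Real.cosh (√(-δ) * t) := by
      ext t
      simp [genCos, h, h.le.not_gt]
    have hs := Real.mul_self_sqrt (neg_pos.2 h).le
    have h0 := (Real.sqrt_pos.2 (neg_pos.2 h)).ne'
    rw [hc]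
    refine ((hasDerivAt_id' t).const_mul √(-δ)).cosh.congr_deriv ?_
    simp only [genSin, h, h.le.not_gt, if_true, if_false]
    field_simp
    rw [sq, hs]
    ring
  · have hc : genCos 0 = fun _ => 1 := by
      ext t
      simp [genCos]
    rw [hc]
    simpa using hasDerivAt_const t (1 : ℝ)
  · have hc : genCos δ = fun t => Real.cos (√δ * t) := by
      ext t
      simp [genCos, h]
    have hs := Real.mul_self_sqrt h.le
    have h0 := (Real.sqrt_pos.2 h).ne'
    rw [hc]
    refine ((hasDerivAt_id' t).const_mul √δ).cos.congr_deriv ?_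
    simp only [genSin, h, if_true]
    field_simp
    rw [sq, hs]
    ring

theorem hasDerivAt_genSin (δ t : ℝ) : HasDerivAt (genSin δ) (genCos δ t) t := by
  rcases lt_trichotomy δ 0 with h | rfl | h
  · have hc : genSin δ = fun t => Real.sinh (√(-δ) * t) / √(-δ) := by
      ext t
      simp [genSin, h, h.le.not_gt]
    have h0 := (Real.sqrt_pos.2 (neg_pos.2 h)).ne'
    rw [hc]
    refine (((hasDerivAt_id' t).const_mul √(-δ)).sinh.div_const √(-δ)).congr_deriv ?_
    simp only [genCos, h, h.le.not_gt, if_true, if_false]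
    field_simp
  · have hc : genSin 0 = fun t => t := by
      ext t
      simp [genSin]
    rw [hc]
    simpa [genCos] using hasDerivAt_id' t
  · have hc : genSin δ = fun t => Real.sin (√δ * t) / √δ := by
      ext t
      simp [genSin, h]
    have h0 := (Real.sqrt_pos.2 h).ne'
    rw [hc]
    refine (((hasDerivAt_id' t).const_mul √δ).sin.div_const √δ).congr_deriv ?_
    simp only [genCos, h, if_true]
    field_simp

theorem genCos_sq_add (δ t : ℝ) : genCos δ t ^ 2 + δ * genSin δ t ^ 2 = 1 := by
  have h : ∀ t, HasDerivAt (fun t => genCos δ t ^ 2 + δ * genSin δ t ^ 2) 0 t := fun t =>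
    (((hasDerivAt_genCos δ t).pow 2).add (((hasDerivAt_genSin δ t).pow 2).const_mul δ)).congr_deriv
      (by push_cast; ring)
  have := is_const_of_deriv_eq_zero (fun t => (h t).differentiableAt) (fun t => (h t).deriv) t 0
  simpa [genCos_zero, genSin_zero] using this

/-- For `δ < 0` the conic is a hyperbola, for `δ = 0` a pair of lines, and the solution runs over
one component only. The other component is its negative, which is the same set of projective points.
For `δ > 0` the solution covers the whole ellipse. -/
theorem exists_genCos_genSin {δ x y : ℝ} (h : x ^ 2 + δ * y ^ 2 = 1) :
    ∃ t, (x = genCos δ t ∧ y = genSin δ t) ∨ (x = -genCos δ t ∧ y = -genSin δ t) := by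
  rcases lt_trichotomy δ 0 with hδ | rfl | hδ
  · have hs := Real.sq_sqrt (neg_pos.2 hδ).le
    have h0 := (Real.sqrt_pos.2 (neg_pos.2 hδ)).ne'
    have key : ∀ {x y : ℝ}, x ^ 2 + δ * y ^ 2 = 1 → 0 ≤ x →
        ∃ t, x = genCos δ t ∧ y = genSin δ t := by
      intro x y h hx
      refine ⟨Real.arsinh (√(-δ) * y) / √(-δ), ?_, ?_⟩
      · simp only [genCos, hδ, hδ.le.not_gt, if_true, if_false]
        rw [mul_div_cancel₀ _ h0, Real.cosh_arsinh, mul_pow, hs,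
          show 1 + -δ * y ^ 2 = x ^ 2 by linarith, Real.sqrt_sq hx]
      · simp only [genSin, hδ, hδ.le.not_gt, if_true, if_false]
        rw [mul_div_cancel₀ _ h0, Real.sinh_arsinh, mul_div_cancel_left₀ _ h0]
    rcases le_total 0 x with hx | hx
    · obtain ⟨t, ht⟩ := key h hx
      exact ⟨t, Or.inl ht⟩
    · obtain ⟨t, h1, h2⟩ := key (x := -x) (y := -y) (by simpa using h) (by linarith)
      exact ⟨t, Or.inr ⟨by linarith, by linarith⟩⟩
  · have hx : x = 1 ∨ x = -1 := by
      apply sq_eq_one_iff.1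
      simpa using h
    rcases hx with rfl | rfl
    · exact ⟨y, Or.inl (by simp [genCos, genSin])⟩
    · exact ⟨-y, Or.inr (by simp [genCos, genSin])⟩
  · have hs := Real.sq_sqrt hδ.le
    have h0 := (Real.sqrt_pos.2 hδ).ne'
    have hn : ‖(⟨x, √δ * y⟩ : ℂ)‖ = 1 := by
      rw [Complex.norm_def, Complex.normSq_mk, Real.sqrt_eq_one]
      linear_combination h + y ^ 2 * hs
    have hz : (⟨x, √δ * y⟩ : ℂ) ≠ 0 := fun e => by simp [e] at hn
    refine ⟨Complex.arg ⟨x, √δ * y⟩ / √δ, Or.inl ⟨?_, ?_⟩⟩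
    · simp only [genCos, hδ, if_true]
      rw [mul_div_cancel₀ _ h0, Complex.cos_arg hz, hn, div_one]
    · simp only [genSin, hδ, if_true]
      rw [mul_div_cancel₀ _ h0, Complex.sin_arg, hn, div_one, mul_div_cancel_left₀ _ h0]

theorem eq_of_continuous_of_mem_multiples {f : ℝ → ℝ} (hf : Continuous f) {c : ℝ} (hc : 0 < c)
    (h : ∀ t, ∃ n : ℤ, f t = n * c) (a b : ℝ) : f a = f b := by
  have key : ∀ a b, f a < f b → False := by
    intro a b hab
    obtain ⟨m, hm⟩ := h a
    obtain ⟨n, hn⟩ := h b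
    have hmn : (m : ℝ) < n := by
      rw [hm, hn] at hab
      exact lt_of_mul_lt_mul_right hab hc.le
    have hmn' : (m : ℝ) + 1 ≤ n := by exact_mod_cast Int.add_one_le_iff.2 (Int.cast_lt.1 hmn)
    -- A continuous function with two different values among the multiples of `c` would take a value
    -- halfway between two consecutive multiples.
    obtain ⟨t, ht⟩ := mem_range_of_exists_le_of_exists_ge hf (c := (m + 1 / 2) * c)
      ⟨a, by rw [hm]; nlinarith⟩ ⟨b, by rw [hn]; nlinarith⟩
    obtain ⟨k, hk⟩ := h t
    rw [hk] at ht
    have hk2 := mul_right_cancel₀ hc.ne' ht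
    have hk3 : 2 * k = 2 * m + 1 := by
      have : (2 * k : ℝ) = 2 * m + 1 := by linarith
      exact_mod_cast this
    omega
  rcases lt_trichotomy (f a) (f b) with hab | hab | hab
  · exact (key _ _ hab).elim
  · exact hab
  · exact (key _ _ hab).elim

/-! ### Matrices of trace zero -/

/-- The exponential of `t U` for a matrix `U` of trace zero. -/
def flow (U : Matrix (Fin 2) (Fin 2) ℝ) (t : ℝ) : Matrix (Fin 2) (Fin 2) ℝ :=
  genCos U.det t • (1 : Matrix (Fin 2) (Fin 2) ℝ) + genSin U.det t • U

theorem flow_zero (U : Matrix (Fin 2) (Fin 2) ℝ) : flow U 0 = 1 := by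
  simp [flow, genCos_zero, genSin_zero]

/-- Cayley–Hamilton; it is why the exponential of `t U` is a combination of `1` and `U`. -/
theorem mul_self_of_trace_eq_zero {U : Matrix (Fin 2) (Fin 2) ℝ} (hU : U.trace = 0) :
    U * U = -U.det • (1 : Matrix (Fin 2) (Fin 2) ℝ) := by
  rw [Matrix.trace_fin_two] at hU
  have h : U 1 1 = -U 0 0 := by linarith
  ext i j
  fin_cases i <;> fin_cases j <;> simp [Matrix.mul_apply, Fin.sum_univ_two, Matrix.det_fin_two, h] <;>
    ring

theorem det_smul_one_add_smul {U : Matrix (Fin 2) (Fin 2) ℝ} (hU : U.trace = 0) (x y : ℝ) :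
    (x • (1 : Matrix (Fin 2) (Fin 2) ℝ) + y • U).det = x ^ 2 + U.det * y ^ 2 := by
  rw [Matrix.trace_fin_two] at hU
  have h : U 1 1 = -U 0 0 := by linarith
  simp [Matrix.det_fin_two, h]
  ring

theorem det_flow {U : Matrix (Fin 2) (Fin 2) ℝ} (hU : U.trace = 0) (t : ℝ) :
    (flow U t).det = 1 := by
  rw [flow, det_smul_one_add_smul hU, genCos_sq_add]

theorem hasDerivAt_mul_flow {U : Matrix (Fin 2) (Fin 2) ℝ} (hU : U.trace = 0)
    (N : Matrix (Fin 2) (Fin 2) ℝ) (t : ℝ) (i j : Fin 2) :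
    HasDerivAt (fun s => (N * flow U s) i j) ((N * flow U t * U) i j) t := by
  have h1 : ∀ s, (N * flow U s) i j = genCos U.det s * N i j + genSin U.det s * (N * U) i j := by
    intro s
    simp [flow, mul_add]
  have h2 : (N * flow U t * U) i j =
      -U.det * genSin U.det t * N i j + genCos U.det t * (N * U) i j := by
    simp only [flow, mul_add, add_mul, Matrix.mul_smul, Matrix.smul_mul, mul_one, mul_assoc,
      mul_self_of_trace_eq_zero hU]
    simp
    ring
  simp only [h1, h2]
  exact ((hasDerivAt_genCos U.det t).mul_const _).add ((hasDerivAt_genSin U.det t).mul_const _)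

theorem eq_mul_flow {U : Matrix (Fin 2) (Fin 2) ℝ} (hU : U.trace = 0)
    {M : ℝ → Matrix (Fin 2) (Fin 2) ℝ}
    (hM : ∀ t i j, HasDerivAt (fun s => M s i j) ((M t * U) i j) t) (t : ℝ) :
    M t = M 0 * flow U t := by
  -- `G t` is the inverse of `flow U t`, that is, the exponential of `-t U`; `M t * G t` has
  -- derivative zero.
  set G : ℝ → Matrix (Fin 2) (Fin 2) ℝ := fun t =>
    genCos U.det t • (1 : Matrix (Fin 2) (Fin 2) ℝ) - genSin U.det t • U with hG
  have hconst : ∀ t, M t * G t = M 0 := by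
    intro t
    ext i j
    have h1 : ∀ s, (M s * G s) i j =
        genCos U.det s * M s i j - genSin U.det s * (M s i 0 * U 0 j + M s i 1 * U 1 j) := by
      intro s
      rw [← Fin.sum_univ_two (fun k => M s i k * U k j), ← Matrix.mul_apply]
      simp [hG, mul_sub]
    have h2 : ∀ s, HasDerivAt (fun s => (M s * G s) i j) 0 s := by
      intro s
      rw [funext h1]
      have h5 : HasDerivAt (fun s => M s i 0 * U 0 j + M s i 1 * U 1 j)
          ((M s * U) i 0 * U 0 j + (M s * U) i 1 * U 1 j) s :=
        ((hM s i 0).mul_const _).add ((hM s i 1).mul_const _)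
      refine (((hasDerivAt_genCos U.det s).mul (hM s i j)).sub
        ((hasDerivAt_genSin U.det s).mul h5)).congr_deriv ?_
      have h3 : (M s * (U * U)) i j =
          (M s * (-U.det • (1 : Matrix (Fin 2) (Fin 2) ℝ))) i j := by
        rw [mul_self_of_trace_eq_zero hU]
      rw [← Matrix.mul_assoc, Matrix.mul_smul, mul_one, Matrix.smul_apply, smul_eq_mul,
        Matrix.mul_apply, Fin.sum_univ_two] at h3
      have h4 : (M s * U) i j = M s i 0 * U 0 j + M s i 1 * U 1 j := by
        rw [Matrix.mul_apply, Fin.sum_univ_two]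
      rw [← h4]
      linear_combination -genSin U.det s * h3
    have := is_const_of_deriv_eq_zero (fun t => (h2 t).differentiableAt) (fun t => (h2 t).deriv) t 0
    simpa [hG, genCos_zero, genSin_zero] using this
  have hGF : G t * flow U t = 1 := by
    have h := genCos_sq_add U.det t
    simp only [hG, flow, mul_add, sub_mul, Matrix.mul_smul, Matrix.smul_mul, mul_one, one_mul,
      mul_self_of_trace_eq_zero hU]
    trans (genCos U.det t ^ 2 + U.det * genSin U.det t ^ 2) • (1 : Matrix (Fin 2) (Fin 2) ℝ)
    · module
    · rw [h, one_smul]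
  rw [← hconst t, Matrix.mul_assoc, hGF, mul_one]

/-! ### The universal cover of `SL(2, ℝ)` -/

namespace SL2Cover

/-- The length of the lower row. -/
def rowNorm (P : SL2Cover) : ℝ := √(P.mat 1 0 ^ 2 + P.mat 1 1 ^ 2)

theorem row_sq_pos {M : Matrix (Fin 2) (Fin 2) ℝ} (h : M.det = 1) : 0 < M 1 0 ^ 2 + M 1 1 ^ 2 := by
  rw [Matrix.det_fin_two] at h
  by_contra hn
  have h0 : M 1 0 = 0 := by nlinarith [sq_nonneg (M 1 0), sq_nonneg (M 1 1)]
  have h1 : M 1 1 = 0 := by nlinarith [sq_nonneg (M 1 0), sq_nonneg (M 1 1)]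
  simp [h0, h1] at h

theorem rowNorm_pos (P : SL2Cover) : 0 < P.rowNorm := Real.sqrt_pos.2 (row_sq_pos P.det_mat)

theorem eq_of_mat_eq_of_angle_eq {P Q : SL2Cover} (h : P.mat = Q.mat) (h' : P.angle = Q.angle) :
    P = Q := by
  cases P
  cases Q
  simp only at h h'
  subst h h'
  rfl

theorem SameProjectivePoint.symm {P Q : SL2Cover} (h : SameProjectivePoint P Q) :
    SameProjectivePoint Q P := by
  rcases h with h | h
  · exact Or.inl h.symm
  · exact Or.inr (by rw [h, neg_neg])

theorem sameProjectivePoint_of_eq_smul {P Q : SL2Cover} {c : ℝ} (h : P.mat = c • Q.mat) :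
    SameProjectivePoint P Q := by
  have h1 := P.det_mat
  rw [h, Matrix.det_smul, Q.det_mat, Fintype.card_fin, mul_one, sq, mul_self_eq_one_iff] at h1
  rcases h1 with rfl | rfl
  · exact Or.inl (by rw [h, one_smul])
  · exact Or.inr (by rw [h, neg_smul, one_smul])

theorem rowNorm_eq {P Q : SL2Cover} (h : SameProjectivePoint P Q) : P.rowNorm = Q.rowNorm := by
  rcases h with h | h <;> simp [rowNorm, h]

theorem SameProjectivePoint.exists_angle {P Q : SL2Cover} (h : SameProjectivePoint P Q) :
    ∃ n : ℤ, P.angle = Q.angle + n * Real.pi := by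
  have hr := rowNorm_eq h
  have hQ := Q.rowNorm_pos
  have c1 : P.mat 1 1 = Q.rowNorm * Real.cos P.angle := hr ▸ P.cos_angle
  have s1 : P.mat 1 0 = Q.rowNorm * Real.sin P.angle := hr ▸ P.sin_angle
  have c2 : Q.mat 1 1 = Q.rowNorm * Real.cos Q.angle := Q.cos_angle
  have s2 : Q.mat 1 0 = Q.rowNorm * Real.sin Q.angle := Q.sin_angle
  have : Real.sin (P.angle - Q.angle) = 0 := by
    have hz : Q.rowNorm ^ 2 * Real.sin (P.angle - Q.angle) = 0 := by
      have : Q.rowNorm ^ 2 * Real.sin (P.angle - Q.angle) =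
          P.mat 1 0 * Q.mat 1 1 - P.mat 1 1 * Q.mat 1 0 := by
        rw [Real.sin_sub, c1, s1, c2, s2]
        ring
      rw [this]
      rcases h with h | h <;> simp [h] <;> ring
    exact (mul_eq_zero.1 hz).resolve_left (by positivity)
  obtain ⟨n, hn⟩ := Real.sin_eq_zero_iff.1 this
  exact ⟨n, by linarith⟩

/-- The angle fixes the direction of the non-zero lower row, hence excludes the opposite matrix. -/
theorem SameProjectivePoint.mat_eq {P Q : SL2Cover} (h : SameProjectivePoint P Q)
    (h' : P.angle = Q.angle) : P.mat = Q.mat := by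
  rcases h with h | h
  · exact h
  exfalso
  have hr := rowNorm_eq (Or.inr h)
  have c1 : P.mat 1 1 = Q.rowNorm * Real.cos Q.angle := h' ▸ hr ▸ P.cos_angle
  have s1 : P.mat 1 0 = Q.rowNorm * Real.sin Q.angle := h' ▸ hr ▸ P.sin_angle
  have c2 : Q.mat 1 1 = Q.rowNorm * Real.cos Q.angle := Q.cos_angle
  have s2 : Q.mat 1 0 = Q.rowNorm * Real.sin Q.angle := Q.sin_angle
  have h1 := row_sq_pos Q.det_mat
  rw [h, Matrix.neg_apply] at c1 s1
  rw [show Q.mat 1 1 = 0 by linarith, show Q.mat 1 0 = 0 by linarith] at h1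
  simp at h1

/-! ### Translation motions -/

theorem IsTranslationMotion.mat_eq {U : Matrix (Fin 2) (Fin 2) ℝ} (hU : U.trace = 0)
    {γ : ℝ → SL2Cover} (h : IsTranslationMotion U γ) (t : ℝ) :
    (γ t).mat = (γ 0).mat * flow U t :=
  eq_mul_flow hU (M := fun t => (γ t).mat) h.1 t

theorem IsTranslationMotion.comp_mul_add {U : Matrix (Fin 2) (Fin 2) ℝ} {γ : ℝ → SL2Cover}
    (h : IsTranslationMotion U γ) (c a : ℝ) :
    IsTranslationMotion (c • U) (fun t => γ (c * t + a)) := by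
  refine ⟨fun t i j => ?_, h.2.comp (by fun_prop)⟩
  have h1 : HasDerivAt (fun t => c * t + a) c t := by
    simpa using ((hasDerivAt_id' t).const_mul c).add_const a
  refine ((h.1 (c * t + a) i j).comp t h1).congr_deriv ?_
  rw [Matrix.mul_smul, Matrix.smul_apply, smul_eq_mul, mul_comm]

/-- A translation motion is determined by its initial point. -/
theorem IsTranslationMotion.eq {U : Matrix (Fin 2) (Fin 2) ℝ} (hU : U.trace = 0)
    {γ γ' : ℝ → SL2Cover} (h : IsTranslationMotion U γ) (h' : IsTranslationMotion U γ')
    (h0 : γ 0 = γ' 0) : γ = γ' := by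
  have hm : ∀ t, (γ t).mat = (γ' t).mat := fun t => by
    rw [h.mat_eq hU, h'.mat_eq hU, h0]
  -- Equal matrices have angles differing by multiples of `π`; the difference is continuous, hence
  -- constant.
  have ha := eq_of_continuous_of_mem_multiples (h.2.sub h'.2) Real.pi_pos (fun t => by
    obtain ⟨n, hn⟩ := SameProjectivePoint.exists_angle (Or.inl (hm t))
    exact ⟨n, by simp [hn]⟩)
  funext t
  refine eq_of_mat_eq_of_angle_eq (hm t) ?_
  have := ha t 0
  simp only [Pi.sub_apply, h0, sub_self] at this
  linarith

theorem exists_isTranslationMotion {U : Matrix (Fin 2) (Fin 2) ℝ} (hU : U.trace = 0)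
    (P : SL2Cover) : ∃ γ, IsTranslationMotion U γ ∧ γ 0 = P := by
  set M : ℝ → Matrix (Fin 2) (Fin 2) ℝ := fun t => P.mat * flow U t with hM
  have hM0 : M 0 = P.mat := by simp [hM, flow_zero]
  have hdet : ∀ t, (M t).det = 1 := fun t => by
    rw [hM, Matrix.det_mul, P.det_mat, det_flow hU, one_mul]
  have hder : ∀ t i j, HasDerivAt (fun s => M s i j) ((M t * U) i j) t := fun t i j =>
    hasDerivAt_mul_flow hU P.mat t i j
  have hcont : ∀ i j, Continuous fun s => M s i j := fun i j =>
    continuous_iff_continuousAt.2 fun t => (hder t i j).continuousAt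
  set z : ℝ → ℂ := fun t => (M t 1 1 : ℂ) + (M t 1 0 : ℂ) * Complex.I with hz
  have hzn : ∀ t, ‖z t‖ = √(M t 1 0 ^ 2 + M t 1 1 ^ 2) := fun t => by
    rw [hz, Complex.norm_add_mul_I, add_comm]
  have hz0 : ∀ t, z t ≠ 0 := fun t h => by
    have h1 := hzn t
    rw [h, norm_zero] at h1
    exact (Real.sqrt_pos.2 (row_sq_pos (hdet t))).ne h1
  have hzc : Continuous z := by
    have := hcont 1 1
    have := hcont 1 0
    fun_prop
  -- A continuous logarithm of the lower row, read as a complex number: its imaginary part is a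
  -- continuous angle. It is later shifted by a constant to start at `P.angle`.
  obtain ⟨f, hf, hfz⟩ := Complex.exists_continuousOn_eqOn_exp_comp (U := (Set.univ : Set ℝ))
    ((Homeomorph.Set.univ ℝ).toHomotopyEquiv.simplyConnectedSpace_iff.2 inferInstance) isOpen_univ hzc.continuousOn
    (by rintro ⟨t, -, ht⟩; exact hz0 t ht)
  have hexp : ∀ t, Complex.exp (f t) = z t := fun t => hfz (Set.mem_univ t)
  have hre : ∀ t, Real.exp (f t).re = √(M t 1 0 ^ 2 + M t 1 1 ^ 2) := fun t => by
    rw [← hzn, ← hexp, Complex.norm_exp]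
  have hcos : ∀ t, M t 1 1 = √(M t 1 0 ^ 2 + M t 1 1 ^ 2) * Real.cos (f t).im := fun t => by
    have := congrArg Complex.re (hexp t)
    rw [Complex.exp_re, hre] at this
    simpa [hz] using this.symm
  have hsin : ∀ t, M t 1 0 = √(M t 1 0 ^ 2 + M t 1 1 ^ 2) * Real.sin (f t).im := fun t => by
    have := congrArg Complex.im (hexp t)
    rw [Complex.exp_im, hre] at this
    simpa [hz] using this.symm
  have h0 : Real.cos P.angle = Real.cos (f 0).im ∧ Real.sin P.angle = Real.sin (f 0).im := by
    have hr := P.rowNorm_pos.ne'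
    have h1 := hcos 0
    have h2 := hsin 0
    rw [hM0] at h1 h2
    exact ⟨mul_left_cancel₀ hr (P.cos_angle.symm.trans h1),
      mul_left_cancel₀ hr (P.sin_angle.symm.trans h2)⟩
  have h3 := Real.cos_sq_add_sin_sq (f 0).im
  have hcos' : ∀ t, Real.cos ((f t).im + (P.angle - (f 0).im)) = Real.cos (f t).im := fun t => by
    rw [Real.cos_add, Real.cos_sub, Real.sin_sub, h0.1, h0.2]
    linear_combination Real.cos (f t).im * h3
  have hsin' : ∀ t, Real.sin ((f t).im + (P.angle - (f 0).im)) = Real.sin (f t).im := fun t => by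
    rw [Real.sin_add, Real.cos_sub, Real.sin_sub, h0.1, h0.2]
    linear_combination Real.sin (f t).im * h3
  refine ⟨fun t => ⟨M t, hdet t, (f t).im + (P.angle - (f 0).im), by rw [hcos']; exact hcos t,
    by rw [hsin']; exact hsin t⟩, ⟨hder, ?_⟩, ?_⟩
  · have := Complex.continuous_im.comp (continuousOn_univ.1 hf)
    exact this.add continuous_const
  · exact eq_of_mat_eq_of_angle_eq hM0 (by simp)

end SL2Cover

/-! ### Elliptic curves and the projective model -/

namespace SL2Cover

/-- Along an elliptic translation curve the angle changes by `π` or `-π` in half a period. -/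
theorem exists_angle_half_period {U : Matrix (Fin 2) (Fin 2) ℝ} (hU : U.trace = 0) (hd : 0 < U.det)
    {γ : ℝ → SL2Cover} (h : IsTranslationMotion U γ) :
    ∃ m : ℤ, (m = 1 ∨ m = -1) ∧
      ∀ t, (γ (t + Real.pi / √U.det)).angle = (γ t).angle + m * Real.pi := by
  set T := Real.pi / √U.det with hT
  have hs := Real.sqrt_pos.2 hd
  have hT0 : 0 < T := div_pos Real.pi_pos hs
  have hperiod : ∀ t, (γ (t + T)).mat = -(γ t).mat := by
    intro t
    have : √U.det * (t + T) = √U.det * t + Real.pi := by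
      rw [hT]
      field_simp
    rw [h.mat_eq hU, h.mat_eq hU t, flow, flow]
    simp only [genCos, genSin, hd, if_true, this, Real.cos_add_pi, Real.sin_add_pi]
    rw [← Matrix.mul_neg, neg_div]
    congr 1
    module
  have hproj : ∀ t, SameProjectivePoint (γ (t + T)) (γ t) := fun t => Or.inr (hperiod t)
  have hconst := eq_of_continuous_of_mem_multiples
    ((h.2.comp (continuous_add_const T)).sub h.2) Real.pi_pos (fun t => by
      obtain ⟨n, hn⟩ := (hproj t).exists_angle
      exact ⟨n, by simp [hn]⟩)
  obtain ⟨m, hm⟩ := (hproj 0).exists_angle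
  -- If the lower row were proportional to its initial value, that row would be a left null vector
  -- of `(genCos - r) • 1 + genSin • U`. The determinant `(genCos - r)² + det U * genSin²` is
  -- positive before half a period.
  have hne : ∀ t ∈ Set.Ioo 0 T, ∀ r : ℝ,
      ¬ ((γ t).mat 1 0 = r * (γ 0).mat 1 0 ∧ (γ t).mat 1 1 = r * (γ 0).mat 1 1) := by
    rintro t ⟨ht0, htT⟩ r ⟨h0, h1⟩
    have hsin : genSin U.det t ≠ 0 := by
      simp only [genSin, hd, if_true]
      refine div_ne_zero (Real.sin_pos_of_pos_of_lt_pi (mul_pos hs ht0) ?_).ne' hs.ne'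
      rw [hT, lt_div_iff₀ hs] at htT
      linarith
    have hdet := det_smul_one_add_smul hU (genCos U.det t - r) (genSin U.det t)
    have hzero : ((genCos U.det t - r) • (1 : Matrix (Fin 2) (Fin 2) ℝ) +
        genSin U.det t • U).det = 0 := by
      rw [← Matrix.exists_vecMul_eq_zero_iff]
      refine ⟨(γ 0).mat 1, ?_, ?_⟩
      · intro hv
        have := row_sq_pos (γ 0).det_mat
        simp [hv] at this
      · have e : ∀ j, (γ t).mat 1 j = r * (γ 0).mat 1 j := by
          intro j
          fin_cases j
          · exact h0
          · exact h1
        ext j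
        have e' := e j
        rw [h.mat_eq hU, Matrix.mul_apply_eq_vecMul, flow] at e'
        simp only [Matrix.vecMul_add, Matrix.vecMul_smul, Matrix.vecMul_one, Pi.add_apply,
          Pi.smul_apply, smul_eq_mul, Pi.zero_apply] at e' ⊢
        linarith
    rw [hzero] at hdet
    have := pow_pos (abs_pos.2 hsin) 2
    rw [sq_abs] at this
    nlinarith [sq_nonneg (genCos U.det t - r)]
  have hno : ∀ s : ℝ, (s = 1 ∨ s = -1) → ∀ t ∈ Set.Ioo 0 T,
      (γ t).angle ≠ (γ 0).angle + s * Real.pi := by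
    intro s hs t ht hang
    apply hne t ht (-((γ t).rowNorm / (γ 0).rowNorm))
    have hr := (γ 0).rowNorm_pos.ne'
    have c0 : (γ 0).mat 1 1 = (γ 0).rowNorm * Real.cos (γ 0).angle := (γ 0).cos_angle
    have s0 : (γ 0).mat 1 0 = (γ 0).rowNorm * Real.sin (γ 0).angle := (γ 0).sin_angle
    have c1 : (γ t).mat 1 1 = (γ t).rowNorm * Real.cos (γ t).angle := (γ t).cos_angle
    have s1 : (γ t).mat 1 0 = (γ t).rowNorm * Real.sin (γ t).angle := (γ t).sin_angle
    have hcs : Real.cos (γ t).angle = -Real.cos (γ 0).angle ∧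
        Real.sin (γ t).angle = -Real.sin (γ 0).angle := by
      rw [hang]
      rcases hs with rfl | rfl
      · simp [Real.cos_add_pi, Real.sin_add_pi]
      · simp [← sub_eq_add_neg, Real.cos_sub_pi, Real.sin_sub_pi]
    rw [c0, s0, c1, s1, hcs.1, hcs.2]
    constructor <;> field_simp
  rw [zero_add] at hm
  -- If `|m| ≥ 2`, the angle would change by `π` or `-π` before half a period, which `hno` excludes.
  -- If `m = 0`, the matrix would equal its negative.
  have hm' : m = 1 ∨ m = -1 := by
    by_contra hm1
    push Not at hm1
    rcases lt_trichotomy m 0 with hneg | rfl | hpos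
    · have hm2 : (m : ℝ) ≤ -2 := by
        have : m ≤ -2 := by omega
        exact_mod_cast this
      obtain ⟨t, ht, hang⟩ := intermediate_value_Ioo' hT0.le h.2.continuousOn
        (show (γ 0).angle + -1 * Real.pi ∈ Set.Ioo (γ T).angle (γ 0).angle by
          constructor <;> nlinarith [Real.pi_pos])
      exact hno (-1) (Or.inr rfl) t ht hang
    · have hang : (γ T).angle = (γ 0).angle := by simp [hm]
      have hp := hproj 0
      have hp' := hperiod 0
      rw [zero_add] at hp hp'
      have h1 := (γ 0).det_mat
      have h2 := row_sq_pos h1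
      rw [hp.mat_eq hang] at hp'
      have h3 : (γ 0).mat 1 0 = -(γ 0).mat 1 0 := congrFun (congrFun hp' 1) 0
      have h4 : (γ 0).mat 1 1 = -(γ 0).mat 1 1 := congrFun (congrFun hp' 1) 1
      nlinarith
    · have hm2 : (2 : ℝ) ≤ m := by
        have : 2 ≤ m := by omega
        exact_mod_cast this
      obtain ⟨t, ht, hang⟩ := intermediate_value_Ioo hT0.le h.2.continuousOn
        (show (γ 0).angle + 1 * Real.pi ∈ Set.Ioo (γ 0).angle (γ T).angle by
          constructor <;> nlinarith [Real.pi_pos])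
      exact hno 1 (Or.inl rfl) t ht hang
  refine ⟨m, hm', fun t => ?_⟩
  have := hconst t 0
  simp only [Pi.sub_apply, Function.comp_apply, zero_add, hm] at this
  linarith

/-- An elliptic translation curve contains all points over the same point of the projective
model as the initial point. -/
theorem mem_range_of_sameProjectivePoint {U : Matrix (Fin 2) (Fin 2) ℝ} (hU : U.trace = 0)
    (hd : 0 < U.det) {γ : ℝ → SL2Cover} (h : IsTranslationMotion U γ) {Q : SL2Cover}
    (hQ : SameProjectivePoint Q (γ 0)) : Q ∈ Set.range γ := by
  obtain ⟨m, hm, hang⟩ := exists_angle_half_period hU hd h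
  set T := Real.pi / √U.det with hT
  have hs := (Real.sqrt_pos.2 hd).ne'
  have hint : ∀ k : ℤ, (γ (k * T)).angle = (γ 0).angle + k * m * Real.pi := by
    intro k
    induction k using Int.induction_on with
    | zero => simp
    | succ i ih =>
      have := hang (i * T)
      push_cast at ih ⊢
      rw [add_mul, one_mul, this, ih]
      ring
    | pred i ih =>
      have := hang ((-i - 1) * T)
      rw [show (-(i : ℝ) - 1) * T + T = -i * T by ring] at this
      push_cast at ih ⊢
      linarith
  obtain ⟨n, hn⟩ := hQ.exists_angle
  have hmm : (m : ℝ) * m = 1 := by rcases hm with rfl | rfl <;> simp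
  -- To change the angle by `n π`, take `n * m` half periods: `m` is its own inverse.
  have hangle : (γ ((n * m : ℤ) * T)).angle = Q.angle := by
    rw [hint, hn]
    push_cast
    linear_combination n * Real.pi * hmm
  have hk : √U.det * (((n * m : ℤ) : ℝ) * T) = ((n * m : ℤ) : ℝ) * Real.pi := by
    rw [hT]
    field_simp
  have hproj : SameProjectivePoint (γ ((n * m : ℤ) * T)) (γ 0) := by
    apply sameProjectivePoint_of_eq_smul (c := genCos U.det ((n * m : ℤ) * T))
    rw [h.mat_eq hU, flow]
    simp only [genSin, hd, if_true, hk, Real.sin_int_mul_pi]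
    simp
  have hQ' : SameProjectivePoint (γ ((n * m : ℤ) * T)) Q := by
    rcases hproj with h1 | h1 <;> rcases hQ with h2 | h2
    · exact Or.inl (by rw [h1, h2])
    · exact Or.inr (by rw [h1, h2, neg_neg])
    · exact Or.inr (by rw [h1, h2])
    · exact Or.inl (by rw [h1, h2])
  exact ⟨_, eq_of_mat_eq_of_angle_eq (hQ'.mat_eq hangle) hangle⟩

theorem exists_motion_through {U : Matrix (Fin 2) (Fin 2) ℝ} {γ : ℝ → SL2Cover}
    (h : IsTranslationMotion U γ) {M : SL2Cover} (hM : M ∈ Set.range γ) :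
    ∃ δ, IsTranslationMotion U δ ∧ δ 0 = M ∧ Set.range δ = Set.range γ := by
  obtain ⟨a, rfl⟩ := hM
  refine ⟨fun t => γ (1 * t + a), by simpa using h.comp_mul_add 1 a, by simp, ?_⟩
  ext Q
  constructor
  · rintro ⟨t, rfl⟩
    exact ⟨_, rfl⟩
  · rintro ⟨t, rfl⟩
    exact ⟨t - a, by simp⟩

theorem exists_curve_motion {g : Set SL2Cover} (hg : g ∈ curves) {M : SL2Cover} (hM : M ∈ g) :
    ∃ U : Matrix (Fin 2) (Fin 2) ℝ, U.trace = 0 ∧ U ≠ 0 ∧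
      ∃ γ, IsTranslationMotion U γ ∧ γ 0 = M ∧ g = Set.range γ := by
  obtain ⟨U, hU, hU0, γ, hγ, rfl⟩ := hg
  obtain ⟨δ, h1, h2, h3⟩ := exists_motion_through hγ hM
  exact ⟨U, hU, hU0, δ, h1, h2, h3.symm⟩

theorem mem_span_of_mem_range {U : Matrix (Fin 2) (Fin 2) ℝ} (hU : U.trace = 0)
    {γ : ℝ → SL2Cover} (h : IsTranslationMotion U γ) {R : SL2Cover} (hR : R ∈ Set.range γ) :
    R.mat ∈ Submodule.span ℝ {(γ 0).mat, (γ 0).mat * U} := by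
  obtain ⟨t, rfl⟩ := hR
  rw [Submodule.mem_span_pair, h.mat_eq hU t]
  exact ⟨genCos U.det t, genSin U.det t, by simp [flow, mul_add]⟩

theorem mat_ne_zero (P : SL2Cover) : P.mat ≠ 0 := fun h => by
  simpa [h] using P.det_mat

theorem mat_mul_cancel (P : SL2Cover) {M N : Matrix (Fin 2) (Fin 2) ℝ}
    (h : P.mat * M = P.mat * N) : M = N := by
  have hu : IsUnit P.mat.det := by simp [P.det_mat]
  have := congrArg (fun X => P.mat⁻¹ * X) h
  simpa [← Matrix.mul_assoc, Matrix.nonsing_inv_mul _ hu] using this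

/-- Taking traces removes the multiple of `1`. So the plane of a curve through `P` determines its
direction up to a scalar. -/
theorem eq_smul_of_eq_smul_one_add {U V : Matrix (Fin 2) (Fin 2) ℝ} (hU : U.trace = 0)
    (hV : V.trace = 0) {x y : ℝ} (h : x • (1 : Matrix (Fin 2) (Fin 2) ℝ) + y • U = V) :
    y • U = V := by
  have := congrArg Matrix.trace h
  rw [Matrix.trace_add, Matrix.trace_smul, Matrix.trace_smul, hU, hV, Matrix.trace_one] at this
  have hx : x = 0 := by simpa using this
  rwa [hx, zero_smul, zero_add] at h

theorem linearIndependent_mat_mul (P : SL2Cover) {U : Matrix (Fin 2) (Fin 2) ℝ} (hU : U.trace = 0)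
    (hU0 : U ≠ 0) : LinearIndependent ℝ ![P.mat, P.mat * U] := by
  rw [LinearIndependent.pair_iff' P.mat_ne_zero]
  intro c hc
  have h1 : c • (1 : Matrix (Fin 2) (Fin 2) ℝ) + (0 : ℝ) • U = U := by
    apply P.mat_mul_cancel
    simpa [mul_add] using hc
  have := eq_smul_of_eq_smul_one_add hU hU h1
  rw [zero_smul] at this
  exact hU0 this.symm

/-- A translation curve is determined by one of its points and its plane. -/
theorem curve_eq_of_span_eq {g h : Set SL2Cover} (hg : g ∈ curves) (hh : h ∈ curves)
    {M P Q P' Q' : SL2Cover} (hMg : M ∈ g) (hPg : P ∈ g) (hQg : Q ∈ g) (hMh : M ∈ h) (hPh : P' ∈ h)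
    (hQh : Q' ∈ h) (hPQ : LinearIndependent ℝ ![P.mat, Q.mat])
    (hPQ' : LinearIndependent ℝ ![P'.mat, Q'.mat])
    (hspan : Submodule.span ℝ {P.mat, Q.mat} = Submodule.span ℝ {P'.mat, Q'.mat}) : g = h := by
  obtain ⟨U, hU, hU0, γ, hγ, rfl, rfl⟩ := exists_curve_motion hg hMg
  obtain ⟨V, hV, hV0, δ, hδ, hM, rfl⟩ := exists_curve_motion hh hMh
  rw [span_pair_eq_of_linearIndependent (linearIndependent_mat_mul (γ 0) hU hU0) hPQ
      (mem_span_of_mem_range hU hγ hPg) (mem_span_of_mem_range hU hγ hQg),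
    span_pair_eq_of_linearIndependent (linearIndependent_mat_mul (δ 0) hV hV0) hPQ'
      (mem_span_of_mem_range hV hδ hPh) (mem_span_of_mem_range hV hδ hQh), hM] at hspan
  have hmem : (γ 0).mat * V ∈ Submodule.span ℝ {(γ 0).mat, (γ 0).mat * U} := by
    rw [hspan]
    exact Submodule.subset_span (by simp)
  obtain ⟨x, y, hxy⟩ := Submodule.mem_span_pair.1 hmem
  have h1 : x • (1 : Matrix (Fin 2) (Fin 2) ℝ) + y • U = V := by
    apply (γ 0).mat_mul_cancel
    simpa [mul_add] using hxy
  have h2 := eq_smul_of_eq_smul_one_add hU hV h1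
  have hy : y ≠ 0 := by
    rintro rfl
    rw [zero_smul] at h2
    exact hV0 h2.symm
  -- The curves start at the same point of the cover and have proportional directions, so they
  -- differ by a change of time scale.
  have hδγ : (fun t => γ (y * t + 0)) = δ :=
    (h2 ▸ hγ.comp_mul_add y 0 : IsTranslationMotion V _).eq hV hδ (by simp [hM])
  rw [← hδγ]
  ext R
  constructor
  · rintro ⟨t, rfl⟩
    exact ⟨t / y, by simp [mul_div_cancel₀ _ hy]⟩
  · rintro ⟨t, rfl⟩
    exact ⟨_, rfl⟩

/-- Through a point there are elliptic translation curves of every type `!![0, a; -1, 0]`; they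
contain all points over the same point of the projective model. -/
theorem exists_elliptic_motion (P : SL2Cover) {a : ℝ} (ha : 0 < a) :
    ∃ γ, IsTranslationMotion !![0, a; -1, 0] γ ∧ γ 0 = P ∧ Set.range γ ∈ curves ∧
      ∀ Q, SameProjectivePoint Q P → Q ∈ Set.range γ := by
  have htr : (!![0, a; -1, 0] : Matrix (Fin 2) (Fin 2) ℝ).trace = 0 := by
    simp [Matrix.trace_fin_two]
  obtain ⟨γ, hγ, rfl⟩ := exists_isTranslationMotion htr P
  refine ⟨γ, hγ, rfl, ⟨_, htr, fun h => ?_, γ, hγ, rfl⟩, fun Q hQ =>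
    mem_range_of_sameProjectivePoint htr (by simpa [Matrix.det_fin_two] using ha) hγ hQ⟩
  simpa using congrFun (congrFun h 1) 0

/-- If the points had the same projective image, two elliptic curves of different types through `P`
would both contain `Q`, and the join would not be unique. -/
theorem linearIndependent_of_isJoin {P Q : SL2Cover} {g : Set SL2Cover}
    (h : IsJoin curves P Q g) : LinearIndependent ℝ ![P.mat, Q.mat] := by
  obtain ⟨-, -, -, -, huniq⟩ := h
  rw [LinearIndependent.pair_iff' P.mat_ne_zero]
  intro c hc
  have hQ := sameProjectivePoint_of_eq_smul hc.symm
  obtain ⟨γ, hγ, hγ0, hγc, hγm⟩ := exists_elliptic_motion P one_pos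
  obtain ⟨δ, hδ, hδ0, hδc, hδm⟩ := exists_elliptic_motion P two_pos
  have heq : Set.range γ = Set.range δ :=
    (huniq _ hγc ⟨0, hγ0⟩ (hγm Q hQ)).trans (huniq _ hδc ⟨0, hδ0⟩ (hδm Q hQ)).symm
  have htr : ∀ a : ℝ, (!![0, a; -1, 0] : Matrix (Fin 2) (Fin 2) ℝ).trace = 0 := fun a => by
    simp [Matrix.trace_fin_two]
  -- At time `π / 2` the first curve has reached `P` times `!![0, 1; -1, 0]`, which is not in the
  -- span of `P` and `P` times `!![0, 2; -1, 0]`.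
  have hmem := mem_span_of_mem_range (htr 2) hδ (heq ▸ ⟨Real.pi / 2, rfl⟩ : γ (Real.pi / 2) ∈ _)
  rw [hγ.mat_eq (htr 1), hγ0, hδ0, Submodule.mem_span_pair] at hmem
  obtain ⟨x, y, hxy⟩ := hmem
  have h1 : x • (1 : Matrix (Fin 2) (Fin 2) ℝ) + y • !![0, 2; -1, 0] =
      flow !![0, 1; -1, 0] (Real.pi / 2) := by
    apply P.mat_mul_cancel
    rw [mul_add, Matrix.mul_smul, Matrix.mul_smul, mul_one]
    exact hxy
  have h2 := congrFun (congrFun h1 0) 1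
  have h3 := congrFun (congrFun h1 1) 0
  simp [flow, genCos, genSin, Matrix.det_fin_two] at h2 h3
  linarith

/-- Two points over different points of the projective model determine a direction. -/
theorem exists_direction {P Q : SL2Cover} (h : LinearIndependent ℝ ![P.mat, Q.mat]) :
    ∃ U : Matrix (Fin 2) (Fin 2) ℝ, U.trace = 0 ∧ U ≠ 0 ∧
      ∃ x : ℝ, Q.mat = P.mat * (x • 1 + U) := by
  have hu : IsUnit P.mat.det := by simp [P.det_mat]
  set A := P.mat⁻¹ * Q.mat with hA
  have hPA : P.mat * A = Q.mat := by
    rw [hA, ← Matrix.mul_assoc, Matrix.mul_nonsing_inv _ hu, one_mul]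
  refine ⟨A - (A.trace / 2) • 1, ?_, ?_, A.trace / 2, ?_⟩
  · simp [Matrix.trace_sub, Matrix.trace_smul]
  · intro h0
    rw [LinearIndependent.pair_iff' P.mat_ne_zero] at h
    apply h (A.trace / 2)
    rw [← hPA]
    conv_rhs => rw [sub_eq_zero.1 h0]
    simp
  · rw [add_sub_cancel, hPA]

/-- The translation curves are mapped to the lines of the projective model. -/
theorem exists_sameProjectivePoint_of_mem_span {U : Matrix (Fin 2) (Fin 2) ℝ} (hU : U.trace = 0)
    {γ : ℝ → SL2Cover} (h : IsTranslationMotion U γ) {X : SL2Cover}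
    (hX : X.mat ∈ Submodule.span ℝ {(γ 0).mat, (γ 0).mat * U}) :
    ∃ t, SameProjectivePoint (γ t) X := by
  obtain ⟨x, y, hxy⟩ := Submodule.mem_span_pair.1 hX
  have h1 : X.mat = (γ 0).mat * (x • 1 + y • U) := by
    rw [← hxy]
    simp [mul_add]
  have h2 := X.det_mat
  rw [h1, Matrix.det_mul, (γ 0).det_mat, one_mul, det_smul_one_add_smul hU] at h2
  obtain ⟨t, ⟨ht1, ht2⟩ | ⟨ht1, ht2⟩⟩ := exists_genCos_genSin h2
  · exact ⟨t, Or.inl (by rw [h1, h.mat_eq hU, flow, ht1, ht2])⟩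
  · refine ⟨t, Or.inr ?_⟩
    rw [h1, h.mat_eq hU, flow, ht1, ht2, ← Matrix.mul_neg]
    congr 1
    module

theorem exists_projective_curve {X Y Z : SL2Cover} (h : LinearIndependent ℝ ![X.mat, Y.mat])
    (hZ : Z.mat ∈ Submodule.span ℝ {X.mat, Y.mat}) :
    ∃ g ∈ curves, X ∈ g ∧ (∃ Q ∈ g, SameProjectivePoint Q Y) ∧ ∃ Q ∈ g, SameProjectivePoint Q Z := by
  obtain ⟨U, hU, hU0, x, hY⟩ := exists_direction h
  obtain ⟨γ, hγ, rfl⟩ := exists_isTranslationMotion hU X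
  have hYm : Y.mat ∈ Submodule.span ℝ {(γ 0).mat, (γ 0).mat * U} := by
    rw [Submodule.mem_span_pair]
    exact ⟨x, 1, by rw [hY]; simp [mul_add]⟩
  obtain ⟨t, ht⟩ := exists_sameProjectivePoint_of_mem_span hU hγ hYm
  obtain ⟨s, hs⟩ := exists_sameProjectivePoint_of_mem_span hU hγ (X := Z) (by
    rwa [← span_pair_eq_of_linearIndependent (linearIndependent_mat_mul (γ 0) hU hU0) h
      (Submodule.subset_span (by simp)) hYm])
  exact ⟨_, ⟨U, hU, hU0, γ, hγ, rfl⟩, ⟨0, rfl⟩, ⟨_, ⟨t, rfl⟩, ht⟩, ⟨_, ⟨s, rfl⟩, hs⟩⟩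

/-- The curve joining `X` and `Z` has the plane of the curve `g` joining `X` and `Y` and shares the
point `X` with it, so the two coincide. If `X` and `Z` have the same projective image, the join of
`Y` and `Z` takes over. -/
theorem exists_curve_of_joinable {X Y Z : SL2Cover} (h : LinearIndependent ℝ ![X.mat, Y.mat])
    (hZ : Z.mat ∈ Submodule.span ℝ {X.mat, Y.mat}) (hXY : Joinable curves X Y)
    (hXZ : Joinable curves X Z) (hYZ : Joinable curves Y Z) :
    ∃ g ∈ curves, X ∈ g ∧ Y ∈ g ∧ Z ∈ g := by
  obtain ⟨g, hg, hXg, hYg⟩ := hXY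
  refine ⟨g, hg, hXg, hYg, ?_⟩
  have hXm : X.mat ∈ Submodule.span ℝ {X.mat, Y.mat} := Submodule.subset_span (by simp)
  have hYm : Y.mat ∈ Submodule.span ℝ {X.mat, Y.mat} := Submodule.subset_span (by simp)
  by_cases hl : LinearIndependent ℝ ![X.mat, Z.mat]
  · obtain ⟨k, hk, hXk, hZk⟩ := hXZ
    rw [curve_eq_of_span_eq hg hk hXg hXg hYg hXk hXk hZk h hl
      (span_pair_eq_of_linearIndependent h hl hXm hZ).symm]
    exact hZk
  · rw [LinearIndependent.pair_iff' X.mat_ne_zero] at hl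
    push Not at hl
    obtain ⟨c, hc⟩ := hl
    have hl' : LinearIndependent ℝ ![Y.mat, Z.mat] := by
      rw [LinearIndependent.pair_iff' Y.mat_ne_zero]
      intro d hd
      have h0 := LinearIndependent.pair_iff.1 h c (-d) (by rw [hc, ← hd]; module)
      apply Z.mat_ne_zero
      rw [← hc, h0.1, zero_smul]
    obtain ⟨k, hk, hYk, hZk⟩ := hYZ
    rw [curve_eq_of_span_eq hg hk hYg hXg hYg hYk hYk hZk h hl'
      (span_pair_eq_of_linearIndependent h hl' hYm hZ).symm]
    exact hZk

theorem desargues {A B : Fin 3 → SL2Cover} {S M₁₂ M₁₃ M₂₃ : SL2Cover}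
    (H : DesarguesConfiguration (surface A) curves A B S M₁₂ M₁₃ M₂₃) :
    (∃ Q₁₂ Q₁₃ Q₂₃ : SL2Cover, SameProjectivePoint Q₁₂ M₁₂ ∧ SameProjectivePoint Q₁₃ M₁₃ ∧
      SameProjectivePoint Q₂₃ M₂₃ ∧ OnOneCurve curves Q₁₂ Q₁₃ Q₂₃) ∧
    (Joinable curves M₁₂ M₁₃ → Joinable curves M₁₂ M₂₃ → Joinable curves M₁₃ M₂₃ →
      OnOneCurve curves M₁₂ M₁₃ M₂₃) := by
  obtain ⟨-, hdep⟩ := DesarguesConfiguration.not_linearIndependent (K := ℝ) (T := Set.univ)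
    (fun P : SL2Cover => P.mat) (Set.subset_univ _) mat_ne_zero (by
      intro P _ Q _ g hj
      have hl := linearIndependent_of_isJoin hj
      obtain ⟨-, hg, hP, hQ, -⟩ := hj
      obtain ⟨U, hU, hU0, γ, hγ, rfl, rfl⟩ := exists_curve_motion hg hP
      refine ⟨hl, fun R hR => ⟨Set.mem_univ R, ?_⟩⟩
      rw [span_pair_eq_of_linearIndependent (linearIndependent_mat_mul (γ 0) hU hU0) hl
        (Submodule.subset_span (by simp)) (mem_span_of_mem_range hU hγ hQ)]
      exact mem_span_of_mem_range hU hγ hR) (by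
      rintro P - Q - P' - Q' - g h hg hh hspan ⟨M, hMg, hMh⟩
      exact curve_eq_of_span_eq hg.2.1 hh.2.1 hMg hg.2.2.1 hg.2.2.2.1 hMh hh.2.2.1 hh.2.2.2.1
        (linearIndependent_of_isJoin hg) (linearIndependent_of_isJoin hh) hspan) H
  rcases exists_pair_of_not_linearIndependent (mat_ne_zero _) hdep with ⟨c, d, hc, hd⟩ |
    ⟨hl, hm⟩ | ⟨hl, hm⟩
  -- All three points are over one projective point, so one elliptic curve contains them without any
  -- assumption on joins.
  · obtain ⟨γ, -, hγ0, hγc, hγm⟩ := exists_elliptic_motion M₁₂ one_pos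
    have h13 := hγm _ (sameProjectivePoint_of_eq_smul hc)
    have h23 := hγm _ (sameProjectivePoint_of_eq_smul hd)
    have hon : OnOneCurve curves M₁₂ M₁₃ M₂₃ := ⟨_, hγc, ⟨0, hγ0⟩, h13, h23⟩
    exact ⟨⟨_, _, _, Or.inl rfl, Or.inl rfl, Or.inl rfl, hon⟩, fun _ _ _ => hon⟩
  · refine ⟨?_, fun h12 h13 h23 => exists_curve_of_joinable hl hm h12 h13 h23⟩
    obtain ⟨g, hg, hX, ⟨Q, hQ, hQY⟩, ⟨R, hR, hRZ⟩⟩ := exists_projective_curve hl hm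
    exact ⟨M₁₂, Q, R, Or.inl rfl, hQY, hRZ, g, hg, hX, hQ, hR⟩
  · refine ⟨?_, fun h12 h13 h23 => ?_⟩
    · obtain ⟨g, hg, hX, ⟨Q, hQ, hQY⟩, ⟨R, hR, hRZ⟩⟩ := exists_projective_curve hl hm
      exact ⟨M₁₂, R, Q, Or.inl rfl, hRZ, hQY, g, hg, hX, hR, hQ⟩
    · obtain ⟨k, hk, h3, h2⟩ := h23
      obtain ⟨g, hg, hX, hY, hZ⟩ := exists_curve_of_joinable hl hm h13 h12 ⟨k, hk, h2, h3⟩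
      exact ⟨g, hg, hX, hZ, hY⟩

end SL2Cover

end Thurston

end

theorem theorem3p2 :
    -- Sol
    (∀ (A B : Fin 3 → Thurston.Sol) (S M₁₂ M₁₃ M₂₃ : Thurston.Sol),
      Thurston.DesarguesConfiguration (Thurston.Sol.surface A) Thurston.Sol.curves
        A B S M₁₂ M₁₃ M₂₃ →
      Thurston.OnOneCurve Thurston.Sol.curves M₁₂ M₁₃ M₂₃) ∧
    -- the universal cover of SL(2, ℝ)
    (∀ (A B : Fin 3 → Thurston.SL2Cover) (S M₁₂ M₁₃ M₂₃ : Thurston.SL2Cover),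
      Thurston.DesarguesConfiguration (Thurston.SL2Cover.surface A) Thurston.SL2Cover.curves
        A B S M₁₂ M₁₃ M₂₃ →
      (∃ Q₁₂ Q₁₃ Q₂₃ : Thurston.SL2Cover,
        Thurston.SL2Cover.SameProjectivePoint Q₁₂ M₁₂ ∧
        Thurston.SL2Cover.SameProjectivePoint Q₁₃ M₁₃ ∧
        Thurston.SL2Cover.SameProjectivePoint Q₂₃ M₂₃ ∧
        Thurston.OnOneCurve Thurston.SL2Cover.curves Q₁₂ Q₁₃ Q₂₃) ∧
      (Thurston.Joinable Thurston.SL2Cover.curves M₁₂ M₁₃ →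
        Thurston.Joinable Thurston.SL2Cover.curves M₁₂ M₂₃ →
        Thurston.Joinable Thurston.SL2Cover.curves M₁₃ M₂₃ →
        Thurston.OnOneCurve Thurston.SL2Cover.curves M₁₂ M₁₃ M₂₃)) ∧
    -- H² × ℝ
    (∀ (A B : Fin 3 → Thurston.H2R) (S M₁₂ M₁₃ M₂₃ : Thurston.H2R),
      Thurston.DesarguesConfiguration (Thurston.H2R.surface A) (Thurston.H2R.curves A)
        A B S M₁₂ M₁₃ M₂₃ →
      Thurston.OnOneCurve (Thurston.H2R.curves A) M₁₂ M₁₃ M₂₃) ∧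
    -- S² × ℝ, triangles of general type
    (∀ (A B : Fin 3 → Thurston.S2R) (S M₁₂ M₁₃ M₂₃ : Thurston.S2R),
      Thurston.S2R.GeneralType A →
      Thurston.DesarguesConfiguration (Thurston.S2R.surface A) (Thurston.S2R.curves A)
        A B S M₁₂ M₁₃ M₂₃ →
      Thurston.OnOneCurve (Thurston.S2R.curves A) M₁₂ M₁₃ M₂₃) ∧
    -- S² × ℝ, triangles of fibre type
    (∀ (A B : Fin 3 → Thurston.S2R) (n : Thurston.S2) (S M₁₂ M₁₃ M₂₃ : Thurston.S2R),
      ¬ Thurston.S2R.GeneralType A →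
      Thurston.DesarguesConfiguration (Thurston.S2R.halfPlane A n) (Thurston.S2R.arcs n)
        A B S M₁₂ M₁₃ M₂₃ →
      Thurston.OnOneCurve (Thurston.S2R.arcs n) M₁₂ M₁₃ M₂₃) := by
  exact ⟨fun _ _ _ _ _ _ H => Thurston.Sol.desargues H,
    fun _ _ _ _ _ _ H => Thurston.SL2Cover.desargues H,
    fun _ _ _ _ _ _ H => Thurston.H2R.desargues H,
    fun _ _ _ _ _ _ hA H => Thurston.S2R.desargues_of_generalType hA H,
    fun _ _ _ _ _ _ _ hA H => Thurston.S2R.desargues_of_fibreType hA H⟩
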